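/- **Setting.** There are $k\ge 1$ players and a coordinator with a threshold $N$. Items arrive one at a time; independently of the others, each item arrives at player $i$ with probability $\mu_i$, where $\sum_{i=1}^k\mu_i=1$ and the $\mu_i$ are unknown to the algorithms. Let $0<\delta<1$ with $k/\delta\ge 2$ (automatic if $k\ge 2$). The communication cost is the total number of messages sent and received by the coordinator. **Rounds.** In a round with threshold $N$ the coordinator sends each player its slack ($k$ messages) and the counters $n_i$ start at $0$; at the $\ell$-th notification the coordinator collects all counters ($2k$ messages) and replaces $N$ by $N-\sum_i n_i$; it stops if nothing is left, and otherwise starts a new round. Thus a round costs $3k+\ell$ messages. The straightforward algorithm costs $k+N$ messages (one to each player, and one for each item). A CMY round has $\ell=k$, and every player notifies each time its counter has grown by $s=\lfloor N/(2k)\rfloor$. The CMY algorithm plays CMY rounds while $N\ge 4k$ and runs the straightforward algorithm as soon as $N<4k$. **The two learning algorithms.** Put $\beta=2\,(2\sqrt2+\tfrac23+3)^2$. At the start of each round: if $N\le 4k$, run the straightforward algorithm to the end; otherwise, if $N\le\beta k\ln\frac k\delta$, run the CMY algorithm to the end; otherwise play one round. The first round is a CMY round. If $w$ items have arrived in it,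 $n_i$ of them at player $i$, put $\bar\mu_i=n_i/w$, $$\hat\mu_i=\bar\mu_i+\sqrt{\frac{2(\bar\mu_i-\bar\mu_i^2)\ln\frac3\delta}{w}}+\frac{3\ln\frac3\delta}{w},\qquad \hat\Sigma=\sum_{i=1}^k\hat\mu_i .$$ In each later round, with current threshold $N$, put $$t=\frac N{\hat\Sigma}-\Bigl(\sqrt2+\frac23\Bigr)\sqrt{k\,\frac N{\hat\Sigma}\ln\frac k\delta}.$$ * *StcSlk-LrnDst*: $\ell=1$, and player $i$ notifies when $n_i$ reaches $s_i=\hat\mu_i t+\sqrt{2t\hat\mu_i\ln\frac k\delta}+\frac23\ln\frac k\delta$. * *DynSlk-LrnDst*: $\ell=k$, and player $i$ notifies each time its counter has grown by $\lfloor (N-t)/(2k)\rfloor$ beyond the base value $b_i=\hat\mu_i t$. **Theorem.** There is an absolute constant $C>0$ such that, for all $k$, $N$, $\delta$ and $(\mu_i)$ as above, each of the two algorithms StcSlk-LrnDst and DynSlk-LrnDst, run with threshold $N$ and parameter $\delta$, terminates with probability at least $1-\delta$ with communication cost at most $$C\Bigl(k\,\log\log\frac{N}{k\ln\frac k\delta}+k\,\log\log\frac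 k\delta\Bigr),$$ where $\log\log x$ is read as $1$ where it is undefined or less than $1$. -/

import Mathlib

namespace DistTracking

noncomputable section

/-- The counters of the players in a round that starts after the first `p` items of the stream `a`,
at the moment when `m` items of the round have arrived (`a j` is the player that receives the
`j`-th item, counted from `0`). -/
def counter {k : ℕ} (a : ℕ → Fin k) (p m : ℕ) (i : Fin k) : ℕ :=
  ((Finset.range m).filter fun j => a (p + j) = i).card

/-- The characteristics of a round of an `ℓ`-Notifications-to-End algorithm: `sent i n` is the
number of notifications that player `i` has sent when its counter has reached `n`, and `ell` is the
number of notifications at which the coordinator ends the round. -/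
structure RoundRule (k : ℕ) where
  sent : Fin k → ℕ → ℕ
  ell : ℕ

/-- The `ell`-th notification is sent on the arrival of the `m`-th item of the round. -/
def RoundRule.EndsAt {k : ℕ} (R : RoundRule k) (a : ℕ → Fin k) (p m : ℕ) : Prop :=
  IsLeast {m' : ℕ | R.ell ≤ ∑ i, R.sent i (counter a p m' i)} m

/-- Messages of one round: `k` slack messages, `ell` notifications, `k` requests for the counters
and `k` answers. -/
def RoundRule.cost {k : ℕ} (R : RoundRule k) : ℕ := k + R.ell + k + k

/-- A CMY round with threshold `N`: slack `⌊N / (2k)⌋` for everybody, one notification for each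
increase of the counter by the slack, `k` notifications to end. -/
def cmyRule (k N : ℕ) : RoundRule k where
  sent _ n := n / (N / (2 * k))
  ell := k

/-- A round with static slacks `s i`: player `i` notifies once, when its counter reaches `s i`; the
first notification ends the round. -/
def staticRule {k : ℕ} (s : Fin k → ℝ) : RoundRule k where
  sent i n := if s i ≤ (n : ℝ) then 1 else 0
  ell := 1

/-- A round with dynamic slacks: player `i` notifies for each increase of its counter by `s` beyond
the base value `b i`; `k` notifications end the round. -/
def dynamicRule {k : ℕ} (b : Fin k → ℝ) (s : ℕ) : RoundRule k where
  sent i n := ⌊((n : ℝ) - b i) / (s : ℝ)⌋₊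
  ell := k

/-- Messages of the straightforward algorithm with threshold `N`: one message to each player to
start it, then one message per item. -/
def directCost (k N : ℕ) : ℕ := k + N

/-- `CMYRun a p N c`: the CMY algorithm, started after the first `p` items of the stream `a` with
threshold `N`, terminates and uses `c` messages in total. -/
inductive CMYRun {k : ℕ} (a : ℕ → Fin k) : ℕ → ℕ → ℕ → Prop
  | alarm (p : ℕ) : CMYRun a p 0 0
  | direct (p N : ℕ) (h0 : 0 < N) (h : N < 4 * k) : CMYRun a p N (directCost k N)
  | round (p N m c : ℕ) (h : 4 * k ≤ N) (hm : (cmyRule k N).EndsAt a p m)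
      (hc : CMYRun a (p + m) (N - m) c) : CMYRun a p N ((cmyRule k N).cost + c)

/-- `FrameworkRun β δ rule a p N c`: the `ℓ`-Notifications-to-End framework with switching
constant `β` and failure parameter `δ`, where a round with threshold `N` is played by `rule N`,
started after the first `p` items of `a` with threshold `N`, terminates and uses `c` messages. -/
inductive FrameworkRun {k : ℕ} (β δ : ℝ) (rule : ℕ → RoundRule k) (a : ℕ → Fin k) :
    ℕ → ℕ → ℕ → Prop
  | alarm (p : ℕ) : FrameworkRun β δ rule a p 0 0
  | direct (p N : ℕ) (h0 : 0 < N) (h : N ≤ 4 * k) :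
      FrameworkRun β δ rule a p N (directCost k N)
  | cmy (p N c : ℕ) (h : 4 * k < N) (hβ : (N : ℝ) ≤ β * (k * Real.log (k / δ)))
      (hc : CMYRun a p N c) : FrameworkRun β δ rule a p N c
  | round (p N m c : ℕ) (h : 4 * k < N) (hβ : β * (k * Real.log (k / δ)) < (N : ℝ))
      (hm : (rule N).EndsAt a p m) (hc : FrameworkRun β δ rule a (p + m) (N - m) c) :
      FrameworkRun β δ rule a p N ((rule N).cost + c)

/-- `LearningRun β δ learn a N c`: the same framework with threshold `N`, but the first round is a
CMY round, and the rule for all later rounds is `learn n`, where `n` are the counters collected at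
the end of the first round. -/
inductive LearningRun {k : ℕ} (β δ : ℝ) (learn : (Fin k → ℕ) → ℕ → RoundRule k)
    (a : ℕ → Fin k) : ℕ → ℕ → Prop
  | alarm : LearningRun β δ learn a 0 0
  | direct (N : ℕ) (h0 : 0 < N) (h : N ≤ 4 * k) : LearningRun β δ learn a N (directCost k N)
  | cmy (N c : ℕ) (h : 4 * k < N) (hβ : (N : ℝ) ≤ β * (k * Real.log (k / δ)))
      (hc : CMYRun a 0 N c) : LearningRun β δ learn a N c
  | learnRound (N w c : ℕ) (h : 4 * k < N) (hβ : β * (k * Real.log (k / δ)) < (N : ℝ))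
      (hw : (cmyRule k N).EndsAt a 0 w)
      (hc : FrameworkRun β δ (learn (counter a 0 w)) a w (N - w) c) :
      LearningRun β δ learn a N ((cmyRule k N).cost + c)

/-- The number `w` of items of the first round, from the collected counters. -/
def total {k : ℕ} (n : Fin k → ℕ) : ℝ := ∑ i, (n i : ℝ)

/-- The empirical frequency of player `i`. -/
def muBar {k : ℕ} (n : Fin k → ℕ) (i : Fin k) : ℝ := (n i : ℝ) / total n

/-- The upper-confidence estimate of the probability of player `i`. -/
def muHat {k : ℕ} (δ : ℝ) (n : Fin k → ℕ) (i : Fin k) : ℝ :=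
  muBar n i + √(2 * (muBar n i - muBar n i ^ 2) * Real.log (3 / δ) / total n)
    + 3 * Real.log (3 / δ) / total n

def sigmaHat {k : ℕ} (δ : ℝ) (n : Fin k → ℕ) : ℝ := ∑ i, muHat δ n i

/-- The number `t` of items that a round with threshold `N` aims at. -/
def target {k : ℕ} (δ : ℝ) (n : Fin k → ℕ) (N : ℕ) : ℝ :=
  N / sigmaHat δ n - (√2 + 2 / 3) * √(k * (N / sigmaHat δ n) * Real.log (k / δ))

/-- The modified static slack `UB_i`. -/
def upperBound {k : ℕ} (δ : ℝ) (n : Fin k → ℕ) (N : ℕ) (i : Fin k) : ℝ :=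
  muHat δ n i * target δ n N + √(2 * target δ n N * muHat δ n i * Real.log (k / δ))
    + 2 / 3 * Real.log (k / δ)

def learnedStaticRule {k : ℕ} (δ : ℝ) (n : Fin k → ℕ) (N : ℕ) : RoundRule k :=
  staticRule (upperBound δ n N)

def learnedDynamicRule {k : ℕ} (δ : ℝ) (n : Fin k → ℕ) (N : ℕ) : RoundRule k :=
  dynamicRule (fun i => muHat δ n i * target δ n N) ⌊((N : ℝ) - target δ n N) / (2 * k)⌋₊

/-- The constant of the switch to CMY in the learning based algorithms. -/
def learnBeta : ℝ := 2 * (2 * √2 + 2 / 3 + 3) ^ 2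

/-- On the stream `a` with threshold `N`, the algorithm StcSlk-LrnDst with failure parameter `δ`
terminates and its communication cost is `c` messages. -/
def StcSlkLrnDst {k : ℕ} (δ : ℝ) (a : ℕ → Fin k) (N c : ℕ) : Prop :=
  LearningRun learnBeta δ (learnedStaticRule δ) a N c

/-- On the stream `a` with threshold `N`, the algorithm DynSlk-LrnDst with failure parameter `δ`
terminates and its communication cost is `c` messages. -/
def DynSlkLrnDst {k : ℕ} (δ : ℝ) (a : ℕ → Fin k) (N c : ℕ) : Prop :=
  LearningRun learnBeta δ (learnedDynamicRule δ) a N c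

/-- `log log x`, replaced by `1` where it is smaller than `1` or undefined. -/
def loglog (x : ℝ) : ℝ := Real.log (max (Real.exp 1) (Real.log x))

end

end DistTracking

open MeasureTheory ProbabilityTheory

namespace DistTracking

/-! Write L = log (k / δ) and x = N / (k L), and let N₀ and x₀ belong to the initial threshold.
Below the switching point everything is deterministic: a CMY round costs 4k messages and removes at
least a third of the threshold, which gives the term k loglog (k / δ). What remains is to bound the
number of rounds above the switching point.

The learning round collects a constant fraction of N₀ items. With probability at least 1 - δ/2 no
player is undercounted in it by more than 3√(μᵢ N₀ L) + 3L (`GoodSample`). The radius in `muHat`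
contains log (3 / δ) and not log (k / δ), so μᵢ ≤ μ̂ᵢ is not claimed for all players at once. The
proof uses only that `muBar ≤ muHat` and that `sigmaHat` exceeds 1 by O(√(kL / N₀)). In a round with
threshold N the estimation error is smaller than the fluctuations of the round itself by the factor
ρ = √(N / N₀) (`GoodSample.mul_target_le`). Hence for small ρ a round comes within a fraction 216ρ
of its target, leaving at most 10√(kLN) + 216ρN items, except with probability 0.99δ. For static
slacks this is a union bound over players with Bernstein-type tails, for dynamic slacks Hoeffding's
inequality and a union bound over sets of players.

After such a round either log x or log (x₀ / x) has changed by a constant factor. While one of these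
logarithms is bounded, a constant fraction of the target is enough. In both cases `potential`, which
starts at O(loglog x₀), drops by 1.

A failed round only wastes O(k) messages and never raises the potential Φ, so no union bound over
rounds is needed: r rounds are insufficient with probability at most (0.99δ + δ/200)^r (200/δ)^Φ,
which is at most δ/2 for some r = O(Φ + 1). For δ near 1 this needs a failure probability below δ by
a constant factor. Bernstein's bound e^(-L) = δ/k per player just misses that, hence the sharpened
`binTail_lt_exp_neg`. -/

/-- A stream of independent items, each of which arrives at player `i` with probability `μ i`. -/
structure IsItemStream {Ω : Type*} [MeasurableSpace Ω] {k : ℕ} (P : Measure Ω)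
    (X : ℕ → Ω → Fin k) (μ : Fin k → ℝ) : Prop where
  meas : ∀ j, Measurable (X j)
  indep : iIndepFun X P
  law : ∀ j i, P.real {ω | X j ω = i} = μ i

/-- The σ-algebra of the items with index in `S`. -/
@[reducible] def itemAlgebra {Ω : Type*} {k : ℕ} (X : ℕ → Ω → Fin k) (S : Set ℕ) : MeasurableSpace Ω :=
  ⨆ j ∈ S, MeasurableSpace.comap (X j) inferInstance

/-! ### Measurability of events and independence of past and future items -/

section Algebra

variable {Ω : Type*} {k : ℕ} {X : ℕ → Ω → Fin k}

theorem itemAlgebra_mono {S T : Set ℕ} (h : S ⊆ T) : itemAlgebra X S ≤ itemAlgebra X T :=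
  biSup_mono fun _ hj => h hj

theorem measurableSet_item {S : Set ℕ} {j : ℕ} (hj : j ∈ S) (A : Set (Fin k)) :
    MeasurableSet[itemAlgebra X S] {ω | X j ω ∈ A} := by
  have h : MeasurableSpace.comap (X j) inferInstance ≤ itemAlgebra X S :=
    le_biSup (fun j => MeasurableSpace.comap (X j) inferInstance) hj
  exact h _ ⟨A, MeasurableSet.of_discrete, rfl⟩

/-- An event that depends on finitely many items only belongs to their σ-algebra. -/
theorem measurableSet_of_dependsOn (J : Finset ℕ) {S : Set ℕ} (hJ : ∀ j ∈ J, j ∈ S)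
    (Q : (ℕ → Fin k) → Prop) (hQ : ∀ a b : ℕ → Fin k, (∀ j ∈ J, a j = b j) → Q a → Q b) :
    MeasurableSet[itemAlgebra X S] {ω | Q fun j => X j ω} := by
  classical
  have key : {ω | Q fun j => X j ω} = ⋃ v : J → Fin k,
      ⋃ _ : (∃ b : ℕ → Fin k, (∀ j : J, b j = v j) ∧ Q b), ⋂ j : J, {ω | X j ω ∈ ({v j} : Set _)} := by
    ext ω
    simp only [Set.mem_ofPred_eq, Set.mem_iUnion, Set.mem_iInter, Set.mem_singleton_iff, exists_prop]
    constructor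
    · intro h
      exact ⟨fun j => X j ω, ⟨_, fun _ => rfl, h⟩, fun _ => rfl⟩
    · rintro ⟨v, ⟨b, hb, hq⟩, hv⟩
      exact hQ b _ (fun j hj => by rw [hb ⟨j, hj⟩, hv ⟨j, hj⟩]) hq
  rw [key]
  refine MeasurableSet.iUnion fun v => MeasurableSet.iUnion fun _ => MeasurableSet.iInter fun j => ?_
  exact measurableSet_item (hJ _ j.2) _

end Algebra

section Stream

variable {Ω : Type*} [MeasurableSpace Ω] {P : Measure Ω} {k : ℕ} {X : ℕ → Ω → Fin k}
  {μ : Fin k → ℝ}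

theorem IsItemStream.itemAlgebra_le (h : IsItemStream P X μ) (S : Set ℕ) :
    itemAlgebra X S ≤ ‹MeasurableSpace Ω› :=
  iSup₂_le fun j _ => (h.meas j).comap_le

theorem IsItemStream.measure_inter (h : IsItemStream P X μ) (q : ℕ) {A B : Set Ω}
    (hA : MeasurableSet[itemAlgebra X (Set.Iio q)] A)
    (hB : MeasurableSet[itemAlgebra X (Set.Ici q)] B) : P (A ∩ B) = P A * P B := by
  have hi : Indep (itemAlgebra X (Set.Iio q)) (itemAlgebra X (Set.Ici q)) P :=
    indep_iSup_of_disjoint (fun j => (h.meas j).comap_le) h.indep.iIndep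
      (Set.disjoint_left.2 fun j h1 h2 => absurd (Set.mem_Iio.1 h1) (not_lt.2 h2))
  exact (Indep_iff _ _ _).1 hi A B hA hB

theorem IsItemStream.nonneg (h : IsItemStream P X μ) (i : Fin k) : 0 ≤ μ i := by
  rw [← h.law 0 i]; exact measureReal_nonneg

variable [IsProbabilityMeasure P]

theorem IsItemStream.measureReal_mem (h : IsItemStream P X μ) (j : ℕ) (A : Finset (Fin k)) :
    P.real {ω | X j ω ∈ A} = ∑ i ∈ A, μ i := by
  have : {ω | X j ω ∈ A} = ⋃ i ∈ A, {ω | X j ω = i} := by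
    ext ω; simp
  rw [this, measureReal_biUnion_finset]
  · exact Finset.sum_congr rfl fun i _ => h.law j i
  · intro a _ b _ hab
    exact Set.disjoint_left.2 fun ω h1 h2 => hab (by simp only [Set.mem_ofPred_eq] at h1 h2; rw [← h1, h2])
  · intro i _
    exact h.meas j (measurableSet_singleton i)

theorem IsItemStream.sum_eq_one (h : IsItemStream P X μ) : ∑ i, μ i = 1 := by
  rw [← h.measureReal_mem 0 Finset.univ]
  simp

theorem IsItemStream.sum_le_one (h : IsItemStream P X μ) (A : Finset (Fin k)) :
    ∑ i ∈ A, μ i ≤ 1 := by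
  rw [← h.measureReal_mem 0 A]
  exact measureReal_le_one

/-- Conditioning on whether the next item arrives at a player of `A`. -/
theorem IsItemStream.measureReal_first (h : IsItemStream P X μ) (p : ℕ) (A : Finset (Fin k))
    {E B C : Set Ω} (hB : MeasurableSet[itemAlgebra X (Set.Ici (p + 1))] B)
    (hC : MeasurableSet[itemAlgebra X (Set.Ici (p + 1))] C)
    (h1 : ∀ ω, X p ω ∈ A → (ω ∈ E ↔ ω ∈ B)) (h2 : ∀ ω, X p ω ∉ A → (ω ∈ E ↔ ω ∈ C)) :
    P.real E = (∑ i ∈ A, μ i) * P.real B + (1 - ∑ i ∈ A, μ i) * P.real C := by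
  have hA : MeasurableSet[itemAlgebra X (Set.Iio (p + 1))] {ω | X p ω ∈ A} :=
    measurableSet_item (S := Set.Iio (p + 1)) (Set.mem_Iio.2 (Nat.lt_succ_self p)) (A : Set (Fin k))
  have hA' := h.itemAlgebra_le _ _ hA
  have e1 : E ∩ {ω | X p ω ∈ A} = {ω | X p ω ∈ A} ∩ B := by
    ext ω; constructor
    · rintro ⟨ha, hb⟩; exact ⟨hb, (h1 ω hb).1 ha⟩
    · rintro ⟨hb, ha⟩; exact ⟨(h1 ω hb).2 ha, hb⟩
  have e2 : E \ {ω | X p ω ∈ A} = {ω | X p ω ∈ A}ᶜ ∩ C := by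
    ext ω; constructor
    · rintro ⟨ha, hb⟩; exact ⟨hb, (h2 ω hb).1 ha⟩
    · rintro ⟨hb, ha⟩; exact ⟨(h2 ω hb).2 ha, hb⟩
  rw [← measureReal_inter_add_sdiff (s := E) hA', e1, e2]
  have i1 := h.measure_inter (p + 1) hA hB
  have i2 := h.measure_inter (p + 1) hA.compl hC
  simp only [measureReal_def, i1, i2, ENNReal.toReal_mul]
  simp only [← measureReal_def]
  rw [probReal_compl_eq_one_sub hA', h.measureReal_mem]

end Stream

/-! ### Item counts: their law and a maximal inequality -/

/-- The number of items received by the players of `A` among the `m` items after the first `p`. -/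
def setCount {k : ℕ} (a : ℕ → Fin k) (p m : ℕ) (A : Finset (Fin k)) : ℕ :=
  ((Finset.range m).filter fun j => a (p + j) ∈ A).card

section Counts

variable {k : ℕ} (a : ℕ → Fin k) (p m : ℕ)

theorem setCount_zero (A : Finset (Fin k)) : setCount a p 0 A = 0 := by simp [setCount]

theorem setCount_succ (A : Finset (Fin k)) :
    setCount a p (m + 1) A = (if a p ∈ A then 1 else 0) + setCount a (p + 1) m A := by
  simp only [setCount, Finset.card_filter, Finset.sum_range_succ']
  rw [add_comm]
  simp only [add_zero]
  congr 1
  refine Finset.sum_congr rfl fun j _ => ?_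
  rw [show p + (j + 1) = p + 1 + j by ring]

theorem counter_eq_setCount (i : Fin k) : counter a p m i = setCount a p m {i} := by
  simp [counter, setCount]

theorem setCount_eq_sum (A : Finset (Fin k)) : setCount a p m A = ∑ i ∈ A, counter a p m i := by
  simp only [setCount, counter, Finset.card_filter]
  rw [Finset.sum_comm]
  refine Finset.sum_congr rfl fun j _ => ?_
  simp

theorem sum_counter : ∑ i, counter a p m i = m := by
  rw [← setCount_eq_sum]; simp [setCount]

theorem counter_mono {m m' : ℕ} (h : m ≤ m') (i : Fin k) : counter a p m i ≤ counter a p m' i := by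
  unfold counter
  exact Finset.card_le_card (Finset.filter_subset_filter _ (Finset.range_subset_range.2 h))

variable {a p m}

theorem setCount_congr {b : ℕ → Fin k} (h : ∀ j ∈ Finset.Ico p (p + m), a j = b j)
    (A : Finset (Fin k)) : setCount a p m A = setCount b p m A := by
  unfold setCount
  congr 1
  refine Finset.filter_congr fun j hj => ?_
  rw [h (p + j) (by simp at hj ⊢; omega)]

theorem counter_congr {b : ℕ → Fin k} (h : ∀ j ∈ Finset.Ico p (p + m), a j = b j) :
    counter a p m = counter b p m := by
  ext i
  rw [counter_eq_setCount, counter_eq_setCount, setCount_congr h]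

end Counts

/-- The probability that the number of successes in `m` independent trials with success probability
`q` is at least `a`. -/
noncomputable def binTail (q : ℝ) : ℕ → ℝ → ℝ
  | 0, a => if a ≤ 0 then 1 else 0
  | m + 1, a => q * binTail q m (a - 1) + (1 - q) * binTail q m a

section Algebra

variable {Ω : Type*} {k : ℕ} {X : ℕ → Ω → Fin k}

theorem measurableSet_setCount (p m : ℕ) (A : Finset (Fin k)) (x : ℝ) :
    MeasurableSet[itemAlgebra X (Set.Ici p)] {ω | x ≤ setCount (fun j => X j ω) p m A} :=
  measurableSet_of_dependsOn (Finset.Ico p (p + m)) (fun j hj => (Finset.mem_Ico.1 hj).1)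
    (fun a => x ≤ setCount a p m A) fun a b hab h => by rwa [setCount_congr hab] at h

theorem measurableSet_crossing (p n : ℕ) (A : Finset (Fin k)) (θ u c : ℝ) :
    MeasurableSet[itemAlgebra X (Set.Ici p)]
      {ω | ∃ m ≤ n, θ * setCount (fun j => X j ω) p m A + u ≤ c * m} :=
  measurableSet_of_dependsOn (Finset.Ico p (p + n)) (fun j hj => (Finset.mem_Ico.1 hj).1)
    (fun a => ∃ m ≤ n, θ * setCount a p m A + u ≤ c * m) fun a b hab ⟨m, hm, h⟩ => ⟨m, hm, by
      rwa [setCount_congr (b := b) fun j hj => hab j (by simp at hj ⊢; omega)] at h⟩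

end Algebra

section Stream

variable {Ω : Type*} [MeasurableSpace Ω] {P : Measure Ω} [IsProbabilityMeasure P] {k : ℕ}
  {X : ℕ → Ω → Fin k} {μ : Fin k → ℝ}

/-- Conditioning on the first item reproduces the recursion of `binTail`. All upper tail bounds can
then be proved by induction on real numbers, without reference to Ω. -/
theorem IsItemStream.measureReal_setCount (h : IsItemStream P X μ) (A : Finset (Fin k)) (m : ℕ) :
    ∀ (p : ℕ) (x : ℝ), P.real {ω | x ≤ setCount (fun j => X j ω) p m A} =
      binTail (∑ i ∈ A, μ i) m x := by
  induction m with
  | zero =>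
    intro p x
    simp only [setCount_zero, binTail, Nat.cast_zero]
    split_ifs with hx <;> simp [hx]
  | succ m ih =>
    intro p x
    rw [h.measureReal_first p A (measurableSet_setCount (p + 1) m A (x - 1))
      (measurableSet_setCount (p + 1) m A x), ih, ih, binTail]
    · intro ω hω
      simp only [Set.mem_ofPred_eq, setCount_succ, if_pos hω]
      push_cast
      constructor <;> intro <;> linarith
    · intro ω hω
      simp only [Set.mem_ofPred_eq, setCount_succ, if_neg hω]
      push_cast
      constructor <;> intro <;> linarith

/-- A maximal inequality: the probability that the count of `A` ever falls below a line. -/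
theorem IsItemStream.measureReal_crossing (h : IsItemStream P X μ) (A : Finset (Fin k)) {θ c : ℝ}
    (hc : (∑ i ∈ A, μ i) * Real.exp (-θ) + (1 - ∑ i ∈ A, μ i) ≤ Real.exp (-c)) (n : ℕ) :
    ∀ (p : ℕ) (u : ℝ), P.real {ω | ∃ m ≤ n, θ * setCount (fun j => X j ω) p m A + u ≤ c * m} ≤
      Real.exp (-u) := by
  have hq0 : 0 ≤ ∑ i ∈ A, μ i := Finset.sum_nonneg fun i _ => h.nonneg i
  have hq1 := h.sum_le_one A
  induction n with
  | zero =>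
    intro p u
    by_cases hu : u ≤ 0
    · exact measureReal_le_one.trans (Real.one_le_exp (by linarith))
    · have : {ω | ∃ m ≤ 0, θ * setCount (fun j => X j ω) p m A + u ≤ c * m} = ∅ := by
        ext ω
        simp [setCount_zero, not_le.1 hu]
      rw [this]; simp [Real.exp_nonneg]
  | succ n ih =>
    intro p u
    -- For u ≤ 0 the bound is at least 1. For u > 0 the line is not met at m = 0, so the first item
    -- can be split off; this changes the intercept to u + θe - c.
    by_cases hu : u ≤ 0
    · exact measureReal_le_one.trans (Real.one_le_exp (by linarith))
    have key : ∀ (ω : Ω) (e : ℕ), ((if X p ω ∈ A then 1 else 0) = e) →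
        ((∃ m ≤ n + 1, θ * setCount (fun j => X j ω) p m A + u ≤ c * m) ↔
          ∃ m ≤ n, θ * setCount (fun j => X j ω) (p + 1) m A + (u + θ * e - c) ≤ c * m) := by
      intro ω e he
      constructor
      · rintro ⟨m, hm, hle⟩
        cases m with
        | zero => simp [setCount_zero] at hle; exact absurd hle hu
        | succ m =>
          refine ⟨m, by omega, ?_⟩
          rw [setCount_succ, he] at hle
          push_cast at hle; linarith
      · rintro ⟨m, hm, hle⟩
        refine ⟨m + 1, by omega, ?_⟩
        rw [setCount_succ, he]
        push_cast; linarith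
    rw [h.measureReal_first (E := {ω | ∃ m ≤ n + 1, θ * setCount (fun j => X j ω) p m A + u ≤ c * m})
      p A (measurableSet_crossing (p + 1) n A θ (u + θ * (1 : ℕ) - c) c)
      (measurableSet_crossing (p + 1) n A θ (u + θ * (0 : ℕ) - c) c)
      (fun ω hω => key ω 1 (if_pos hω)) (fun ω hω => key ω 0 (if_neg hω))]
    -- `hc` says that exp (c m - θ S_m), with S_m the count, is a supermartingale; this is its
    -- maximal inequality, one item at a time.
    calc _ ≤ (∑ i ∈ A, μ i) * Real.exp (-(u + θ * (1 : ℕ) - c)) +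
          (1 - ∑ i ∈ A, μ i) * Real.exp (-(u + θ * (0 : ℕ) - c)) := by
            gcongr
            · exact ih _ _
            · exact ih _ _
      _ = ((∑ i ∈ A, μ i) * Real.exp (-θ) + (1 - ∑ i ∈ A, μ i)) * Real.exp (-u + c) := by
            rw [show -(u + θ * ((1 : ℕ) : ℝ) - c) = -θ + (-u + c) by push_cast; ring,
              show -(u + θ * ((0 : ℕ) : ℝ) - c) = -u + c by push_cast; ring, Real.exp_add]
            ring
      _ ≤ Real.exp (-c) * Real.exp (-u + c) := by gcongr
      _ = Real.exp (-u) := by rw [← Real.exp_add]; ring_nf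

end Stream

/-! ### Upper tails of the binomial distribution -/

section Tail

variable {q : ℝ}

theorem binTail_le_exp (h0 : 0 ≤ q) (h1 : q ≤ 1) {θ : ℝ} (hθ : 0 ≤ θ) (m : ℕ) :
    ∀ a : ℝ, binTail q m a ≤ Real.exp (-θ * a) * (1 + q * (Real.exp θ - 1)) ^ m := by
  induction m with
  | zero =>
    intro a
    simp only [binTail, pow_zero, mul_one]
    split_ifs with ha
    · exact Real.one_le_exp (by nlinarith)
    · exact Real.exp_nonneg _
  | succ m ih =>
    intro a
    have h1' : 0 ≤ 1 - q := by linarith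
    calc binTail q (m + 1) a = q * binTail q m (a - 1) + (1 - q) * binTail q m a := rfl
      _ ≤ q * (Real.exp (-θ * (a - 1)) * (1 + q * (Real.exp θ - 1)) ^ m) +
          (1 - q) * (Real.exp (-θ * a) * (1 + q * (Real.exp θ - 1)) ^ m) := by
            gcongr <;> exact ih _
      _ = _ := by
            rw [show -θ * (a - 1) = -θ * a + θ by ring, Real.exp_add]; ring

theorem one_add_pow_le_exp {y : ℝ} (hy : 0 ≤ 1 + y) (m : ℕ) : (1 + y) ^ m ≤ Real.exp (m * y) := by
  rw [Real.exp_nat_mul]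
  gcongr
  linarith [Real.add_one_le_exp y]

theorem binTail_le_exp_of_le (h0 : 0 ≤ q) (h1 : q ≤ 1) {θ τ : ℝ} (hθ : 0 ≤ θ) {m : ℕ}
    (hτ : m * q ≤ τ) (a : ℝ) :
    binTail q m a ≤ Real.exp (-θ * a + τ * (Real.exp θ - 1)) := by
  have he : 0 ≤ Real.exp θ - 1 := by linarith [Real.one_le_exp hθ]
  refine (binTail_le_exp h0 h1 hθ m a).trans ?_
  rw [Real.exp_add]
  gcongr
  refine (one_add_pow_le_exp (by positivity) m).trans (Real.exp_le_exp.2 ?_)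
  nlinarith

/-- Markov's inequality for `e ^ (θ Y) (Y - u) ^ 2`, where `Y` is binomially distributed. -/
theorem binTail_le_exp_mul_sq (h0 : 0 ≤ q) (h1 : q ≤ 1) {θ : ℝ} (hθ : 0 ≤ θ) {M g : ℝ}
    (hM : M = 1 + q * (Real.exp θ - 1)) (hg : M * g = q * Real.exp θ) (m : ℕ) :
    ∀ a u : ℝ, u < a → binTail q m a ≤
      Real.exp (-θ * a) * M ^ m * ((m * (g * (1 - g)) + (m * g - u) ^ 2) / (a - u) ^ 2) := by
  have he : 0 ≤ Real.exp θ - 1 := by linarith [Real.one_le_exp hθ]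
  induction m with
  | zero =>
    intro a u hu
    simp only [binTail, pow_zero, mul_one, Nat.cast_zero, zero_mul, zero_add, zero_sub, neg_sq]
    split_ifs with ha
    · refine one_le_mul_of_one_le_of_one_le (Real.one_le_exp (by nlinarith)) ?_
      rw [one_le_div (by have := sub_pos.2 hu; positivity)]
      nlinarith
    · positivity
  | succ m ih =>
    intro a u hu
    have h1' : 0 ≤ 1 - q := by linarith
    have hd : (a - u) ^ 2 ≠ 0 := by have := sub_pos.2 hu; positivity
    -- `M` is the moment generating function of one trial and `g` the success probability under the
    -- tilted measure, so the numerator is the tilted second moment of Y - u.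
    calc binTail q (m + 1) a = q * binTail q m (a - 1) + (1 - q) * binTail q m a := rfl
      _ ≤ q * (Real.exp (-θ * (a - 1)) * M ^ m *
            ((m * (g * (1 - g)) + (m * g - (u - 1)) ^ 2) / (a - 1 - (u - 1)) ^ 2)) +
          (1 - q) * (Real.exp (-θ * a) * M ^ m *
            ((m * (g * (1 - g)) + (m * g - u) ^ 2) / (a - u) ^ 2)) := by
            gcongr
            · exact ih _ _ (by linarith)
            · exact ih _ _ hu
      _ = Real.exp (-θ * a) * M ^ m * ((M * g * (m * (g * (1 - g)) + (m * g - (u - 1)) ^ 2) +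
            (M - M * g) * (m * (g * (1 - g)) + (m * g - u) ^ 2)) / (a - u) ^ 2) := by
            rw [show -θ * (a - 1) = -θ * a + θ by ring, Real.exp_add,
              show a - 1 - (u - 1) = a - u by ring, hg, hM]
            field_simp
            ring
      _ = _ := by
            push_cast
            rw [pow_succ]
            field_simp
            ring

/-- A Chernoff bound, improved by Cantelli's inequality under the tilted measure. -/
theorem binTail_le_exp_mul_div (h0 : 0 ≤ q) (h1 : q ≤ 1) {θ τ a d : ℝ} (hθ : 0 ≤ θ) {m : ℕ}
    (hτ : m * q ≤ τ) (hτ0 : 0 < τ) (hd : 0 < d) (hda : d ≤ a - τ * Real.exp θ) :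
    binTail q m a ≤ Real.exp (-θ * a + τ * (Real.exp θ - 1)) *
      (τ * Real.exp θ / (τ * Real.exp θ + d ^ 2)) := by
  have he : 0 ≤ Real.exp θ - 1 := by linarith [Real.one_le_exp hθ]
  obtain ⟨M, hM⟩ : ∃ M, M = 1 + q * (Real.exp θ - 1) := ⟨_, rfl⟩
  have hM1 : 1 ≤ M := by rw [hM]; nlinarith [mul_nonneg h0 he]
  have hM0 : 0 < M := by linarith
  obtain ⟨g, hg⟩ : ∃ g, M * g = q * Real.exp θ := ⟨q * Real.exp θ / M, by field_simp⟩
  have hg0 : 0 ≤ g := by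
    have : 0 ≤ M * g := by rw [hg]; positivity
    exact nonneg_of_mul_nonneg_right this hM0
  have hg1 : g ≤ 1 := by
    have : M * g ≤ M * 1 := by rw [hg, hM]; linarith
    exact le_of_mul_le_mul_left this hM0
  have hmg : m * g ≤ τ * Real.exp θ := by
    have : g ≤ q * Real.exp θ := by rw [← hg]; nlinarith
    calc m * g ≤ m * (q * Real.exp θ) := by gcongr
      _ = m * q * Real.exp θ := by ring
      _ ≤ _ := by gcongr
  set V : ℝ := m * (g * (1 - g)) with hV
  have hV0 : 0 ≤ V := by have : 0 ≤ 1 - g := by linarith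
                         positivity
  have hV1 : V ≤ τ * Real.exp θ := by
    refine le_trans ?_ hmg
    rw [hV]; gcongr; nlinarith
  set D := a - m * g with hD
  have hdD : d ≤ D := by linarith
  have hD0 : 0 < D := by linarith
  -- Cantelli's choice of u minimises the quotient and turns it into V / (V + D²).
  have key := binTail_le_exp_mul_sq h0 h1 hθ hM hg m a (m * g - V / D) (by
    have : 0 ≤ V / D := by positivity
    linarith)
  have e1 : (V + (m * g - (m * g - V / D)) ^ 2) / (a - (m * g - V / D)) ^ 2 = V / (V + D ^ 2) := by
    rw [show a - (m * g - V / D) = D + V / D by rw [hD]; ring]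
    have : 0 < V + D ^ 2 := by positivity
    have h3 : D + V / D = (V + D ^ 2) / D := by field_simp; ring
    rw [h3]
    field_simp
    ring
  rw [← hV, e1] at key
  refine key.trans ?_
  rw [Real.exp_add]
  have hT : 0 < τ * Real.exp θ := by positivity
  have e2 : V / (V + D ^ 2) ≤ τ * Real.exp θ / (τ * Real.exp θ + d ^ 2) := by
    rw [div_le_div_iff₀ (by positivity) (by positivity)]
    have : d ^ 2 ≤ D ^ 2 := by gcongr
    nlinarith [mul_le_mul hV1 this (by positivity) hT.le]
  have e3 : M ^ m ≤ Real.exp (τ * (Real.exp θ - 1)) := by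
    rw [hM]
    refine (one_add_pow_le_exp (by positivity) m).trans (Real.exp_le_exp.2 ?_)
    nlinarith
  gcongr

/-- From the quadratic term on, (n + 2)! ≥ 2 · 3ⁿ bounds the series by a geometric one. -/
theorem exp_le_of_lt_three {θ : ℝ} (h0 : 0 ≤ θ) (h3 : θ < 3) :
    Real.exp θ ≤ 1 + θ + θ ^ 2 / (2 * (1 - θ / 3)) := by
  have hs : HasSum (fun n : ℕ => θ ^ n / n.factorial) (Real.exp θ) := by
    rw [Real.exp_eq_exp_ℝ]
    exact NormedSpace.expSeries_div_hasSum_exp θ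
  have h2 := (hasSum_nat_add_iff' 2).2 hs
  have hg : HasSum (fun n : ℕ => θ ^ 2 / 2 * (θ / 3) ^ n) (θ ^ 2 / 2 * (1 - θ / 3)⁻¹) :=
    (hasSum_geometric_of_lt_one (by positivity) (by linarith)).mul_left _
  have := hasSum_le (fun n => ?_) h2 hg
  · have hp : 0 < 1 - θ / 3 := by linarith
    simp [Finset.sum_range_succ] at this
    have e : θ ^ 2 / (2 * (1 - θ / 3)) = θ ^ 2 / 2 * (1 - θ / 3)⁻¹ := by field_simp
    rw [e]; linarith
  · have hf : ((2 * 3 ^ n : ℕ) : ℝ) ≤ ((n + 2).factorial : ℕ) := by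
      have := Nat.factorial_mul_pow_le_factorial (m := 2) (n := n)
      rw [add_comm n 2]
      exact_mod_cast this
    push_cast at hf
    calc θ ^ (n + 2) / ((n + 2).factorial : ℝ) ≤ θ ^ (n + 2) / (2 * 3 ^ n) := by gcongr
      _ = θ ^ 2 / 2 * (θ / 3) ^ n := by rw [div_pow, pow_add]; field_simp

/-- Chernoff's bound with θ = v / (1 + v/3). The coefficient c stays free: c = 1/3 is Bernstein's
inequality, and c = 7/12 yields a surplus when v is not small. -/
theorem binTail_le_bernstein (h0 : 0 ≤ q) (h1 : q ≤ 1) {τ B v c a : ℝ} {m : ℕ} (hτ : m * q ≤ τ)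
    (hv : 0 ≤ v) (hB : τ * v ^ 2 = 2 * B) (ha : τ + τ * v + c * B ≤ a) :
    binTail q m a ≤ Real.exp (-(B * (1 + c * v) / (1 + v / 3))) := by
  have hτ0 : 0 ≤ τ := le_trans (by positivity) hτ
  have hd : 0 < 1 + v / 3 := by positivity
  have hθ : 0 ≤ v / (1 + v / 3) := by positivity
  have h3 : v / (1 + v / 3) < 3 := by rw [div_lt_iff₀ hd]; linarith
  have he := exp_le_of_lt_three hθ h3
  refine (binTail_le_exp_of_le h0 h1 hθ hτ a).trans (Real.exp_le_exp.2 ?_)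
  have e1 : (v / (1 + v / 3)) ^ 2 / (2 * (1 - v / (1 + v / 3) / 3)) = v ^ 2 / 2 / (1 + v / 3) := by
    have : 1 - v / (1 + v / 3) / 3 = 1 / (1 + v / 3) := by field_simp; ring
    rw [this]; field_simp
  rw [e1] at he
  calc -(v / (1 + v / 3)) * a + τ * (Real.exp (v / (1 + v / 3)) - 1)
      ≤ -(v / (1 + v / 3)) * (τ + τ * v + c * B) +
        τ * (v / (1 + v / 3) + v ^ 2 / 2 / (1 + v / 3)) := by
        have := mul_le_mul_of_nonneg_left ha hθ
        have h4 := mul_le_mul_of_nonneg_left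
          (show Real.exp (v / (1 + v / 3)) - 1 ≤ v / (1 + v / 3) + v ^ 2 / 2 / (1 + v / 3) by linarith) hτ0
        linarith
    _ = -((τ * v ^ 2 / 2 + c * B * v) / (1 + v / 3)) := by field_simp; ring
    _ = _ := by rw [hB]; congr 2; ring

/-- Bernstein's inequality. -/
theorem binTail_le_exp_neg (h0 : 0 ≤ q) (h1 : q ≤ 1) {τ B a : ℝ} {m : ℕ} (hτ : m * q ≤ τ)
    (hτ0 : 0 < τ) (hB : 0 ≤ B) (ha : τ + √(2 * τ * B) + B / 3 ≤ a) :
    binTail q m a ≤ Real.exp (-B) := by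
  have hv : τ * √(2 * B / τ) = √(2 * τ * B) := by
    rw [show 2 * τ * B = τ ^ 2 * (2 * B / τ) by field_simp, Real.sqrt_mul (by positivity),
      Real.sqrt_sq hτ0.le]
  have := binTail_le_bernstein (c := 1 / 3) (v := √(2 * B / τ)) (B := B) (a := a) h0 h1 hτ
    (Real.sqrt_nonneg _) (by rw [Real.sq_sqrt (by positivity)]; field_simp) (by rw [hv]; linarith)
  have hs := Real.sqrt_nonneg (2 * B / τ)
  rwa [show B * (1 + 1 / 3 * √(2 * B / τ)) / (1 + √(2 * B / τ) / 3) = B by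
    have : 0 < 1 + √(2 * B / τ) / 3 := by positivity
    field_simp] at this

/-- Here s = √τ and g = √(2L). The tilt θ = (g - 1) / s, in place of g / s, puts the tilted mean
about one standard deviation below a. This costs a factor √e ≤ 1.65, but Cantelli's inequality then
contributes 0.56, and 1.65 · 0.56 < 0.99. -/
theorem binTail_le_of_large_mean (h0 : 0 ≤ q) (h1 : q ≤ 1) {s g a : ℝ} {m : ℕ} (hs : 0 < s)
    (hτ : m * q ≤ s ^ 2) (hg : 1.177 ≤ g) (hgs : g ^ 3 < 0.16 * s)
    (ha : s ^ 2 + g * s + 7 / 24 * g ^ 2 ≤ a) :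
    binTail q m a ≤ 0.99 * Real.exp (-(g ^ 2 / 2)) := by
  obtain ⟨θ, hθ⟩ : ∃ θ, θ * s = g - 1 := ⟨(g - 1) / s, by field_simp⟩
  have hθ0 : 0 ≤ θ := by nlinarith
  have hgs2 : g ^ 2 ≤ 0.136 * s := by nlinarith [sq_nonneg g]
  have hgs1 : g ≤ 0.1156 * s := by nlinarith
  have hθ1 : θ ≤ 0.1156 := by
    by_contra! h
    nlinarith
  have hs10 : 10 ≤ s := by nlinarith
  have he : Real.exp θ ≤ 1 + θ + θ ^ 2 / 2 + θ ^ 3 * (2 / 11) := by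
    refine (exp_le_of_lt_three hθ0 (by linarith)).trans ?_
    have hp : 0 < 1 - θ / 3 := by linarith
    have : θ ^ 2 / (2 * (1 - θ / 3)) ≤ θ ^ 2 / 2 + θ ^ 3 * (2 / 11) := by
      rw [div_le_iff₀ (by positivity)]
      have h3 : 0 ≤ θ ^ 3 := by positivity
      have h4 : 0 ≤ θ ^ 3 * (1 / 33 - 4 / 33 * θ) := mul_nonneg h3 (by linarith)
      linarith [show (θ ^ 2 / 2 + θ ^ 3 * (2 / 11)) * (2 * (1 - θ / 3)) =
        θ ^ 2 + θ ^ 3 * (1 / 33 - 4 / 33 * θ) by ring]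
    linarith
  have hb : s ^ 2 * θ ^ 2 = (g - 1) ^ 2 := by rw [← hθ]; ring
  have h1s : s ^ 2 * θ = (g - 1) * s := by rw [← hθ]; ring
  have h3s : s ^ 2 * θ ^ 3 = θ * (g - 1) ^ 2 := by rw [← hθ]; ring
  have hse : s ^ 2 * Real.exp θ ≤
      s ^ 2 + (g - 1) * s + (g - 1) ^ 2 / 2 + θ * (g - 1) ^ 2 * (2 / 11) := by
    have := mul_le_mul_of_nonneg_left he (sq_nonneg s)
    linarith [show s ^ 2 * (1 + θ + θ ^ 2 / 2 + θ ^ 3 * (2 / 11)) = s ^ 2 + s ^ 2 * θ +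
      s ^ 2 * θ ^ 2 / 2 + s ^ 2 * θ ^ 3 * (2 / 11) by ring]
  have hgg : (g - 1) ^ 2 ≤ g ^ 2 := by nlinarith
  have hc : θ * (g - 1) ^ 2 ≤ 0.1156 * (0.136 * s) := by
    have : (g - 1) ^ 2 ≤ 0.136 * s := by linarith
    gcongr
  have hd : 0.96 * s ≤ a - s ^ 2 * Real.exp θ := by linarith
  have hexp : -θ * a + s ^ 2 * (Real.exp θ - 1) ≤ -(g ^ 2 / 2) + 1 / 2 := by
    have h2 := mul_le_mul_of_nonneg_left ha hθ0
    have h4 : θ * ((g - 1) ^ 2 * (2 / 11)) ≤ θ * (7 / 24 * g ^ 2) := by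
      refine mul_le_mul_of_nonneg_left ?_ hθ0
      linarith [sq_nonneg g]
    have h5 : θ * (s ^ 2 + g * s + 7 / 24 * g ^ 2) =
      (g - 1) * s + (g - 1) * g + θ * (7 / 24 * g ^ 2) := by rw [← hθ]; ring
    linarith [show (g - 1) * g = (g - 1) ^ 2 / 2 + g ^ 2 / 2 - 1 / 2 by ring]
  refine (binTail_le_exp_mul_div h0 h1 hθ0 hτ (by positivity) (by positivity) hd).trans ?_
  have hr : s ^ 2 * Real.exp θ / (s ^ 2 * Real.exp θ + (0.96 * s) ^ 2) ≤ 0.56 := by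
    have : Real.exp θ ≤ 1.13 := by
      have h2 : θ ^ 2 ≤ 0.1156 ^ 2 := by gcongr
      have h3 : θ ^ 3 ≤ 0.1156 ^ 3 := by gcongr
      norm_num at h2 h3 hθ1 ⊢
      linarith
    rw [div_le_iff₀ (by positivity)]
    have h4 := mul_le_mul_of_nonneg_left this (sq_nonneg s)
    linarith [show (0.96 * s) ^ 2 = 0.9216 * s ^ 2 by ring, sq_nonneg s]
  have hh : Real.exp (1 / 2) ≤ 1.65 := by
    have h1 := Real.exp_one_lt_d9
    have h2 : Real.exp (1 / 2) ^ 2 = Real.exp 1 := by rw [← Real.exp_nat_mul]; norm_num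
    by_contra! h
    have : (1.65 : ℝ) ^ 2 < Real.exp (1 / 2) ^ 2 := by gcongr
    norm_num at this h2 h1
    linarith
  calc _ ≤ Real.exp (-(g ^ 2 / 2) + 1 / 2) * 0.56 := by gcongr
    _ = Real.exp (-(g ^ 2 / 2)) * (Real.exp (1 / 2) * 0.56) := by rw [Real.exp_add]; ring
    _ ≤ Real.exp (-(g ^ 2 / 2)) * 0.99 := by gcongr; linarith
    _ = _ := by ring

/-- A tail bound slightly below Bernstein's `exp (-L)`. -/
theorem binTail_lt_exp_neg (h0 : 0 ≤ q) (h1 : q ≤ 1) {τ L a : ℝ} {m : ℕ} (hτ : m * q ≤ τ)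
    (hτ0 : 0 < τ) (hL : 0.693 ≤ L) (ha : τ + √(2 * τ * L) + 7 / 12 * L ≤ a) :
    binTail q m a ≤ 0.99 * Real.exp (-L) := by
  obtain ⟨g, hgdef⟩ : ∃ g, g = √(2 * L) := ⟨_, rfl⟩
  obtain ⟨s, hsdef⟩ : ∃ s, s = √τ := ⟨_, rfl⟩
  have hs0 : 0 < s := by rw [hsdef]; positivity
  have hs2 : s ^ 2 = τ := by rw [hsdef, Real.sq_sqrt hτ0.le]
  have hg2 : g ^ 2 = 2 * L := by rw [hgdef, Real.sq_sqrt (by linarith)]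
  have hg0 : 0 ≤ g := by rw [hgdef]; positivity
  have hg : 1.177 ≤ g := by by_contra! h; nlinarith
  have hgs : √(2 * τ * L) = g * s := by
    rw [hgdef, hsdef, ← Real.sqrt_mul (by linarith)]; ring_nf
  rw [hgs] at ha
  -- For a large mean the gain comes from Cantelli's inequality, otherwise from the surplus 7/12 -
  -- 1/3 = 1/4 over Bernstein's coefficient of L.
  by_cases hc : g ^ 3 < 0.16 * s
  · have := binTail_le_of_large_mean h0 h1 hs0 (by rwa [hs2]) hg hc (a := a) (by
      rw [hs2, hg2]; linarith)
    rwa [hg2, show 2 * L / 2 = L by ring] at this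
  · push Not at hc
    have hv : 0 < g / s := by positivity
    have := binTail_le_bernstein (c := 7 / 12) (v := g / s) (B := L) (a := a) h0 h1 hτ
      hv.le (by rw [← hs2, ← hg2]; field_simp) (by
        have : τ * (g / s) = g * s := by rw [← hs2]; field_simp
        rw [this]; linarith)
    refine this.trans ?_
    set v := g / s with hvdef
    have hLv : 0.08 ≤ L * v := by
      have : L * v = g ^ 3 / 2 / s := by rw [hvdef, show L = g ^ 2 / 2 by linarith]; field_simp
      rw [this, le_div_iff₀ hs0]; linarith
    have hgain : 0.015 ≤ L * v / 4 / (1 + v / 3) := by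
      rw [le_div_iff₀ (by positivity)]
      nlinarith
    have e : -(L * (1 + 7 / 12 * v) / (1 + v / 3)) = -L + -(L * v / 4 / (1 + v / 3)) := by
      field_simp; ring
    rw [e, Real.exp_add, mul_comm]
    gcongr
    calc Real.exp (-(L * v / 4 / (1 + v / 3))) ≤ Real.exp (-0.015) := by gcongr
      _ ≤ 0.99 := by
        rw [Real.exp_neg, inv_le_comm₀ (Real.exp_pos _) (by norm_num)]
        linarith [Real.add_one_le_exp 0.015]

/-- The fixed slope θ = 4, with e⁴ ≤ 55, serves where the mean is tiny compared with a. -/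
theorem binTail_le_exp_four (h0 : 0 ≤ q) (h1 : q ≤ 1) {τ a : ℝ} {m : ℕ} (hτ : m * q ≤ τ) :
    binTail q m a ≤ Real.exp (-4 * a + 54 * τ) := by
  have hτ0 : 0 ≤ τ := le_trans (by positivity) hτ
  refine (binTail_le_exp_of_le h0 h1 (θ := 4) (by norm_num) hτ a).trans (Real.exp_le_exp.2 ?_)
  have : Real.exp 4 ≤ 55 := by
    have h := Real.exp_one_lt_d9
    have : Real.exp 4 = Real.exp 1 ^ 4 := by rw [← Real.exp_nat_mul]; norm_num
    rw [this]
    calc Real.exp 1 ^ 4 ≤ 2.7182818286 ^ 4 := by gcongr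
      _ ≤ 55 := by norm_num
  nlinarith

/-- Hoeffding's lemma for a Bernoulli variable. -/
theorem one_add_mul_exp_sub_one_le (h0 : 0 ≤ q) (h1 : q ≤ 1) (θ : ℝ) :
    1 + q * (Real.exp θ - 1) ≤ Real.exp (θ * q + θ ^ 2 / 8) := by
  let ν : Measure ℝ := ENNReal.ofReal q • Measure.dirac 1 + ENNReal.ofReal (1 - q) • Measure.dirac 0
  have hν : IsProbabilityMeasure ν := ⟨by
    simp [ν, ← ENNReal.ofReal_add h0 (sub_nonneg.2 h1)]⟩
  have hint : ∀ f : ℝ → ℝ, ∫ x, f x ∂ν = q * f 1 + (1 - q) * f 0 := by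
    intro f
    rw [integral_add_measure, integral_smul_measure, integral_smul_measure, integral_dirac,
      integral_dirac, ENNReal.toReal_ofReal h0, ENNReal.toReal_ofReal (sub_nonneg.2 h1)]
    · simp
    · exact (integrable_dirac (by simp)).smul_measure ENNReal.ofReal_ne_top
    · exact (integrable_dirac (by simp)).smul_measure ENNReal.ofReal_ne_top
  have hsub := hasSubgaussianMGF_of_mem_Icc (μ := ν) (X := id) (a := 0) (b := 1) aemeasurable_id (by
    simp only [ν]
    rw [ae_add_measure_iff]
    constructor <;> exact Measure.ae_smul_measure (by simp [ae_dirac_eq]) _)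
  have := hsub.mgf_le θ
  rw [mgf, hint, hint] at this
  simp only [id, mul_one, mul_zero, add_zero] at this
  norm_num at this
  have e1 : q * Real.exp (θ * (1 - q)) + (1 - q) * Real.exp (-(θ * q)) =
      (1 + q * (Real.exp θ - 1)) * Real.exp (-(θ * q)) := by
    rw [show θ * (1 - q) = θ + -(θ * q) by ring, Real.exp_add]; ring
  rw [e1] at this
  calc 1 + q * (Real.exp θ - 1)
      = (1 + q * (Real.exp θ - 1)) * Real.exp (-(θ * q)) * Real.exp (θ * q) := by
        rw [mul_assoc, ← Real.exp_add]; simp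
    _ ≤ Real.exp (1 / 4 * θ ^ 2 / 2) * Real.exp (θ * q) := by gcongr
    _ = _ := by rw [← Real.exp_add]; ring_nf

/-- Hoeffding's inequality. -/
theorem binTail_le_hoeffding (h0 : 0 ≤ q) (h1 : q ≤ 1) {m : ℕ} {n y : ℝ} (hm : (m : ℝ) ≤ n)
    (hn : 0 < n) (hy : 0 ≤ y) : binTail q m (m * q + y) ≤ Real.exp (-(2 * y ^ 2 / n)) := by
  have hθ : 0 ≤ 4 * y / n := by positivity
  refine (binTail_le_exp h0 h1 hθ m _).trans ?_
  have he : 0 ≤ 1 + q * (Real.exp (4 * y / n) - 1) := by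
    nlinarith [Real.exp_nonneg (4 * y / n)]
  calc _ ≤ Real.exp (-(4 * y / n) * (m * q + y)) *
        Real.exp (4 * y / n * q + (4 * y / n) ^ 2 / 8) ^ m := by
        gcongr
        exact one_add_mul_exp_sub_one_le h0 h1 _
    _ = Real.exp (-(4 * y ^ 2 / n) + m * ((4 * y / n) ^ 2 / 8)) := by
        rw [← Real.exp_nat_mul, ← Real.exp_add]; congr 1; ring
    _ ≤ Real.exp (-(4 * y ^ 2 / n) + n * ((4 * y / n) ^ 2 / 8)) := by gcongr
    _ = _ := by congr 1; field_simp; ring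

end Tail

/-! ### Rounds, and the decay of the probability that many rounds are not enough -/

section Rounds

variable {k : ℕ} {R : RoundRule k} {a : ℕ → Fin k} {p m : ℕ}

theorem RoundRule.endsAt_iff : R.EndsAt a p m ↔
    R.ell ≤ ∑ i, R.sent i (counter a p m i) ∧
      ∀ m' < m, ∑ i, R.sent i (counter a p m' i) < R.ell := by
  unfold RoundRule.EndsAt IsLeast lowerBounds
  simp only [Set.mem_ofPred_eq]
  refine and_congr_right fun _ => ⟨fun h m' hm' => ?_, fun h m' hm' => ?_⟩
  · by_contra! hc
    exact absurd (h hc) (not_le.2 hm')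
  · by_contra! hc
    exact absurd (h m' hc) (not_lt.2 hm')

theorem RoundRule.EndsAt.congr {b : ℕ → Fin k} (hab : ∀ j ∈ Finset.Ico p (p + m), a j = b j)
    (h : R.EndsAt a p m) : R.EndsAt b p m := by
  rw [RoundRule.endsAt_iff] at h ⊢
  refine ⟨by rw [← counter_congr hab]; exact h.1, fun m' hm' => ?_⟩
  rw [← counter_congr (a := a) fun j hj => hab j (by simp at hj ⊢; omega)]
  exact h.2 m' hm'

/-- Pigeonhole. It makes rounds end on every stream, not just almost surely. -/
theorem exists_le_counter (hk : 0 < k) (a : ℕ → Fin k) (p n : ℕ) :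
    ∃ i, n ≤ counter a p (k * n) i := by
  by_contra! h
  have h1 := sum_counter a p (k * n)
  have : ∑ i : Fin k, counter a p (k * n) i < ∑ _i : Fin k, n :=
    Finset.sum_lt_sum_of_nonempty ⟨⟨0, hk⟩, Finset.mem_univ _⟩ fun i _ => h i
  simp at this
  omega

theorem RoundRule.exists_endsAt (hk : 0 < k) (hR : ∃ n₀, ∀ i, ∀ n ≥ n₀, R.ell ≤ R.sent i n)
    (a : ℕ → Fin k) (p : ℕ) : ∃ m, R.EndsAt a p m := by
  classical
  obtain ⟨n₀, h⟩ := hR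
  obtain ⟨i, hi⟩ := exists_le_counter hk a p n₀
  have hne : ∃ m, R.ell ≤ ∑ i, R.sent i (counter a p m i) :=
    ⟨k * n₀, (h i _ hi).trans
      (Finset.single_le_sum (f := fun i => R.sent i (counter a p (k * n₀) i))
        (fun _ _ => Nat.zero_le _) (Finset.mem_univ i))⟩
  exact ⟨Nat.find hne, Nat.find_spec hne, fun m' hm' => Nat.find_min' hne hm'⟩

/-- After `n` rounds played by `rule` the remaining threshold still exceeds `T`, and it did so
before each of them. -/
def Unfinished {k : ℕ} (T : ℝ) (rule : ℕ → RoundRule k) (a : ℕ → Fin k) : ℕ → ℕ → ℕ → Prop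
  | 0, _, N => T < N
  | n + 1, p, N => T < N ∧ ∃ m, (rule N).EndsAt a p m ∧ Unfinished T rule a n (p + m) (N - m)

theorem Unfinished.lt {T : ℝ} {rule : ℕ → RoundRule k} {n N : ℕ}
    (h : Unfinished T rule a n p N) : T < N := by
  cases n with
  | zero => exact h
  | succ n => exact h.1

end Rounds

section Measurability

variable {Ω : Type*} {k : ℕ} {X : ℕ → Ω → Fin k}

theorem measurableSet_endsAt (R : RoundRule k) (p m : ℕ) {S : Set ℕ}
    (hS : ∀ j ∈ Finset.Ico p (p + m), j ∈ S) :
    MeasurableSet[itemAlgebra X S] {ω | R.EndsAt (fun j => X j ω) p m} :=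
  measurableSet_of_dependsOn (Finset.Ico p (p + m)) hS (fun a => R.EndsAt a p m)
    fun _ _ hab h => h.congr hab

theorem measurableSet_unfinished (T : ℝ) (rule : ℕ → RoundRule k) (n : ℕ) :
    ∀ p N : ℕ, MeasurableSet[itemAlgebra X (Set.Ici p)]
      {ω | Unfinished T rule (fun j => X j ω) n p N} := by
  induction n with
  | zero => intro p N; exact MeasurableSet.const _
  | succ n ih =>
    intro p N
    have : {ω | Unfinished T rule (fun j => X j ω) (n + 1) p N} = {_ω | T < N} ∩
        ⋃ m, ({ω | (rule N).EndsAt (fun j => X j ω) p m} ∩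
          {ω | Unfinished T rule (fun j => X j ω) n (p + m) (N - m)}) := by
      ext ω
      simp [Unfinished]
    rw [this]
    refine (MeasurableSet.const _).inter (MeasurableSet.iUnion fun m => MeasurableSet.inter ?_ ?_)
    · exact measurableSet_endsAt _ _ _ fun j hj => (Finset.mem_Ico.1 hj).1
    · exact itemAlgebra_mono (Set.Ici_subset_Ici.2 (Nat.le_add_right p m)) _ (ih _ _)

theorem pairwise_disjoint_endsAt (R : RoundRule k) (p : ℕ) :
    Pairwise (Function.onFun Disjoint fun m => {ω | R.EndsAt (fun j => X j ω) p m}) :=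
  fun _ _ hne => Set.disjoint_left.2 fun _ h1 h2 => hne (IsLeast.unique h1 h2)

end Measurability

section Probability

variable {Ω : Type*} [MeasurableSpace Ω] {P : Measure Ω} [IsProbabilityMeasure P] {k : ℕ}
  {X : ℕ → Ω → Fin k} {μ : Fin k → ℝ}

/-- The strong Markov property, as a bound: if the disjoint events `A i` are decided by the first
`q i` items, and the events `B i` of probability at most `b` by the items after these, then the
probability that some `A i` happens together with `B i` is at most `b` times that of `⋃ A i`. -/
theorem IsItemStream.measureReal_iUnion_inter_le (h : IsItemStream P X μ) {ι : Type*} [Countable ι]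
    (q : ι → ℕ) {A B : ι → Set Ω} (hA : ∀ i, MeasurableSet[itemAlgebra X (Set.Iio (q i))] (A i))
    (hB : ∀ i, MeasurableSet[itemAlgebra X (Set.Ici (q i))] (B i))
    (hd : Pairwise (Function.onFun Disjoint A)) {b : ℝ} (hb : 0 ≤ b) (hPB : ∀ i, P.real (B i) ≤ b) :
    P.real (⋃ i, A i ∩ B i) ≤ b * P.real (⋃ i, A i) := by
  have key : P (⋃ i, A i ∩ B i) ≤ ENNReal.ofReal b * P (⋃ i, A i) := by
    rw [measure_iUnion hd fun i => h.itemAlgebra_le _ _ (hA i), ← ENNReal.tsum_mul_left]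
    refine (measure_iUnion_le _).trans (ENNReal.tsum_le_tsum fun i => ?_)
    rw [h.measure_inter (q i) (hA i) (hB i), mul_comm]
    gcongr
    rw [← ofReal_measureReal]
    exact ENNReal.ofReal_le_ofReal (hPB i)
  have := ENNReal.toReal_mono (ENNReal.mul_ne_top ENNReal.ofReal_ne_top (measure_ne_top _ _)) key
  rwa [ENNReal.toReal_mul, ENNReal.toReal_ofReal hb] at this

/-- If every round with threshold `N` fails to collect `target N` items with probability at most
`f`, and the weight `W` of the threshold shrinks by the factor `κ` otherwise, then the probability
that `n` rounds are not enough decays like `(f + κ) ^ n`. -/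
theorem IsItemStream.measureReal_unfinished_le (h : IsItemStream P X μ) {T : ℝ}
    {rule : ℕ → RoundRule k} {N₀ : ℕ} {W : ℕ → ℝ} {f κ : ℝ} (hf : 0 ≤ f) (hκ : 0 ≤ κ)
    (hW1 : ∀ N : ℕ, T < N → N ≤ N₀ → 1 ≤ W N)
    (hWm : ∀ N N' : ℕ, T < N' → N' ≤ N → N ≤ N₀ → W N' ≤ W N)
    (hstep : ∀ N : ℕ, T < N → N ≤ N₀ → ∃ t : ℕ, (T < (N - t : ℕ) → W (N - t) ≤ κ * W N) ∧
      ∀ p, P.real {ω | ∃ m < t, (rule N).EndsAt (fun j => X j ω) p m} ≤ f) (n : ℕ) :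
    ∀ p N : ℕ, T < N → N ≤ N₀ →
      P.real {ω | Unfinished T rule (fun j => X j ω) n p N} ≤ (f + κ) ^ n * W N := by
  induction n with
  | zero =>
    intro p N hT hN
    rw [pow_zero, one_mul]
    exact measureReal_le_one.trans (hW1 N hT hN)
  | succ n ih =>
    intro p N hT hN
    obtain ⟨t, ht, hfail⟩ := hstep N hT hN
    have hWN : 0 ≤ W N := zero_le_one.trans (hW1 N hT hN)
    set E : ℕ → Set Ω := fun m => {ω | (rule N).EndsAt (fun j => X j ω) p m} with hE
    set U : ℕ → Set Ω := fun m => {ω | Unfinished T rule (fun j => X j ω) n (p + m) (N - m)} with hU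
    have hEm : ∀ m, MeasurableSet[itemAlgebra X (Set.Iio (p + m))] (E m) := fun m =>
      measurableSet_endsAt _ _ _ fun j hj => (Finset.mem_Ico.1 hj).2
    have hUm : ∀ m, MeasurableSet[itemAlgebra X (Set.Ici (p + m))] (U m) := fun m =>
      measurableSet_unfinished _ _ _ _ _
    have hUb : ∀ m (b : ℝ), 0 ≤ b → (T < (N - m : ℕ) → (f + κ) ^ n * W (N - m) ≤ b) →
        P.real (U m) ≤ b := by
      intro m b hb hm
      by_cases hTm : T < (N - m : ℕ)
      · exact (ih _ _ hTm (by omega)).trans (hm hTm)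
      · have : U m = ∅ := Set.eq_empty_of_forall_notMem fun ω hω => hTm (Unfinished.lt hω)
        rw [this]; simpa using hb
    -- A round that ends before `t` items has probability at most f and leaves a weight of at most W
    -- N; any other round leaves at most κ W N.
    have hsub : {ω | Unfinished T rule (fun j => X j ω) (n + 1) p N} ⊆
        (⋃ m : {m // m < t}, E m ∩ U m) ∪ ⋃ m : {m // t ≤ m}, E m ∩ U m := by
      rintro ω ⟨_, m, hm, hu⟩
      rcases lt_or_ge m t with hmt | hmt
      · exact Or.inl (Set.mem_iUnion.2 ⟨⟨m, hmt⟩, hm, hu⟩)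
      · exact Or.inr (Set.mem_iUnion.2 ⟨⟨m, hmt⟩, hm, hu⟩)
    have b1 := h.measureReal_iUnion_inter_le (ι := {m // m < t}) (fun m => p + m) (fun m => hEm m)
      (fun m => hUm m) (fun i j hij => pairwise_disjoint_endsAt _ _ fun hc => hij (Subtype.ext hc))
      (b := (f + κ) ^ n * W N) (by positivity) fun m => hUb m _ (by positivity) fun hm => by
        gcongr; exact hWm _ _ hm (by omega) hN
    have b2 := h.measureReal_iUnion_inter_le (ι := {m // t ≤ m}) (fun m => p + m) (fun m => hEm m)
      (fun m => hUm m) (fun i j hij => pairwise_disjoint_endsAt _ _ fun hc => hij (Subtype.ext hc))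
      (b := (f + κ) ^ n * (κ * W N)) (by positivity) fun m => hUb m _ (by positivity) fun hm => by
        gcongr
        have hle : N - (m : ℕ) ≤ N - t := Nat.sub_le_sub_left m.2 N
        have hTt : T < (N - t : ℕ) := hm.trans_le (by exact_mod_cast hle)
        exact (hWm _ _ hm hle (by omega)).trans (ht hTt)
    have e1 : (⋃ m : {m // m < t}, E m) = {ω | ∃ m < t, (rule N).EndsAt (fun j => X j ω) p m} := by
      ext ω; simp [hE]
    have hf' := hfail p
    rw [← e1] at hf'
    have h1 : P.real (⋃ m : {m // t ≤ m}, E m) ≤ 1 := measureReal_le_one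
    calc P.real {ω | Unfinished T rule (fun j => X j ω) (n + 1) p N}
        ≤ P.real (⋃ m : {m // m < t}, E m ∩ U m) + P.real (⋃ m : {m // t ≤ m}, E m ∩ U m) :=
          (measureReal_mono hsub).trans (measureReal_union_le _ _)
      _ ≤ (f + κ) ^ n * W N * f + (f + κ) ^ n * (κ * W N) * 1 := by
          refine add_le_add (b1.trans ?_) (b2.trans ?_) <;> gcongr
      _ = (f + κ) ^ (n + 1) * W N := by ring

end Probability

/-! ### Deterministic analysis of CMY rounds and of the framework -/

section CMY

variable {k : ℕ} {a : ℕ → Fin k} {p m N : ℕ}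

theorem cmyRule_exists_endsAt (hk : 0 < k) (hN : 2 * k ≤ N) (a : ℕ → Fin k) (p : ℕ) :
    ∃ m, (cmyRule k N).EndsAt a p m := by
  have hs : 0 < N / (2 * k) := Nat.div_pos hN (by omega)
  refine RoundRule.exists_endsAt hk ⟨k * (N / (2 * k)), fun i n hn => ?_⟩ a p
  exact (Nat.le_div_iff_mul_le hs).2 hn

theorem le_of_cmyRule_endsAt (h : (cmyRule k N).EndsAt a p m) : k * (N / (2 * k)) ≤ m := by
  have h1 : k ≤ ∑ i, counter a p m i / (N / (2 * k)) := (RoundRule.endsAt_iff.1 h).1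
  calc k * (N / (2 * k)) ≤ (∑ i, counter a p m i / (N / (2 * k))) * (N / (2 * k)) := by gcongr
    _ ≤ ∑ i, counter a p m i := by
        rw [Finset.sum_mul]
        exact Finset.sum_le_sum fun i _ => Nat.div_mul_le_self _ _
    _ = m := sum_counter a p m

/-- One item before the end fewer than k slacks are complete, and each of the k counters holds less
than one further slack. -/
theorem cmyRule_endsAt_le (hk : 0 < k) (hN : 2 * k ≤ N) (h : (cmyRule k N).EndsAt a p m) :
    m ≤ N := by
  have hs : 0 < N / (2 * k) := Nat.div_pos hN (by omega)
  have hsN : 2 * k * (N / (2 * k)) ≤ N := Nat.mul_div_le N (2 * k)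
  refine le_trans ?_ hsN
  cases m with
  | zero => exact Nat.zero_le _
  | succ m =>
    have h1 : ∑ i, counter a p m i / (N / (2 * k)) < k :=
      (RoundRule.endsAt_iff.1 h).2 m (Nat.lt_succ_self m)
    set s := N / (2 * k)
    have h2 : m < 2 * k * s := by
      calc m = ∑ i, counter a p m i := (sum_counter a p m).symm
        _ < ∑ i : Fin k, (counter a p m i / s + 1) * s :=
            Finset.sum_lt_sum_of_nonempty ⟨⟨0, hk⟩, Finset.mem_univ _⟩ fun i _ => by
              rw [mul_comm]; exact Nat.lt_mul_div_succ _ hs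
        _ = (∑ i : Fin k, counter a p m i / s) * s + k * s := by
            rw [← Finset.sum_mul, Finset.sum_add_distrib]; simp; ring
        _ ≤ k * s + k * s := by gcongr
        _ = 2 * k * s := by ring
    exact h2

theorem exists_cmyRun (hk : 0 < k) (a : ℕ → Fin k) (j : ℕ) :
    ∀ p N : ℕ, (N : ℝ) < 4 * k * (3 / 2) ^ j → ∃ c, CMYRun a p N c ∧ c ≤ 4 * k * j + 5 * k := by
  have small : ∀ p N : ℕ, N < 4 * k → ∃ c, CMYRun a p N c ∧ c ≤ 5 * k := by
    intro p N hN
    rcases Nat.eq_zero_or_pos N with rfl | h0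
    · exact ⟨0, .alarm p, by omega⟩
    · exact ⟨_, .direct p N h0 hN, by unfold directCost; omega⟩
  induction j with
  | zero =>
    intro p N hN
    simp only [pow_zero, mul_one] at hN
    simpa using small p N (by exact_mod_cast hN)
  | succ j ih =>
    intro p N hN
    rcases lt_or_ge N (4 * k) with h4 | h4
    · obtain ⟨c, hc, hle⟩ := small p N h4
      exact ⟨c, hc, by rw [mul_add]; omega⟩
    obtain ⟨m, hm⟩ := cmyRule_exists_endsAt hk (by omega : 2 * k ≤ N) a p
    have h1 := le_of_cmyRule_endsAt hm
    have hs : 2 ≤ N / (2 * k) := (Nat.le_div_iff_mul_le (by omega)).2 (by omega)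
    -- The slack s is at least 2, so N < 2k(s + 1) ≤ 3ks ≤ 3m.
    have h3 : N ≤ 3 * m := by
      have h2 : N < 2 * k * (N / (2 * k) + 1) := Nat.lt_mul_div_succ N (by omega)
      nlinarith
    have h5 : ((N - m : ℕ) : ℝ) < 4 * k * (3 / 2) ^ j := by
      have : 3 * (N - m) ≤ 2 * N := by omega
      have : 3 * ((N - m : ℕ) : ℝ) ≤ 2 * N := by exact_mod_cast this
      rw [pow_succ] at hN
      linarith
    obtain ⟨c, hc, hle⟩ := ih (p + m) (N - m) h5
    refine ⟨_, .round p N m c h4 hm hc, ?_⟩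
    simp only [RoundRule.cost, cmyRule]
    rw [mul_add]; omega

end CMY

/-- If `n` rounds bring the threshold to the switching point, then the framework terminates. -/
theorem exists_frameworkRun {k : ℕ} {β δ : ℝ} {rule : ℕ → RoundRule k} {a : ℕ → Fin k} {B N₀ : ℕ}
    (hT : (4 * k : ℝ) ≤ β * (k * Real.log (k / δ)))
    (hrule : ∀ N : ℕ, N ≤ N₀ → β * (k * Real.log (k / δ)) < N → ∀ p, ∃ m, (rule N).EndsAt a p m)
    (hcost : ∀ N : ℕ, (rule N).cost ≤ 4 * k) (hB : 5 * k ≤ B)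
    (hcmy : ∀ p N : ℕ, (N : ℝ) ≤ β * (k * Real.log (k / δ)) → ∃ c, CMYRun a p N c ∧ c ≤ B) (n : ℕ) :
    ∀ p N : ℕ, N ≤ N₀ → ¬ Unfinished (β * (k * Real.log (k / δ))) rule a n p N →
      ∃ c, FrameworkRun β δ rule a p N c ∧ c ≤ 4 * k * n + B := by
  have small : ∀ p N : ℕ, (N : ℝ) ≤ β * (k * Real.log (k / δ)) →
      ∃ c, FrameworkRun β δ rule a p N c ∧ c ≤ B := by
    intro p N hN
    rcases Nat.eq_zero_or_pos N with rfl | h0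
    · exact ⟨0, .alarm p, by omega⟩
    rcases le_or_gt N (4 * k) with h4 | h4
    · exact ⟨_, .direct p N h0 h4, by unfold directCost; omega⟩
    · obtain ⟨c, hc, hle⟩ := hcmy p N hN
      exact ⟨c, .cmy p N c h4 hN hc, hle⟩
  induction n with
  | zero =>
    intro p N _ h
    simpa using small p N (not_lt.1 h)
  | succ n ih =>
    intro p N hN₀ h
    rcases le_or_gt (N : ℝ) (β * (k * Real.log (k / δ))) with hN | hN
    · obtain ⟨c, hc, hle⟩ := small p N hN
      exact ⟨c, hc, by omega⟩
    obtain ⟨m, hm⟩ := hrule N hN₀ hN p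
    have hu : ¬ Unfinished (β * (k * Real.log (k / δ))) rule a n (p + m) (N - m) :=
      fun hu => h ⟨hN, m, hm, hu⟩
    obtain ⟨c, hc, hle⟩ := ih _ _ (by omega) hu
    have h4 : 4 * k < N := by exact_mod_cast hT.trans_lt hN
    refine ⟨_, .round p N m c h4 hN hm hc, ?_⟩
    have := hcost N
    rw [mul_add]; omega

/-! ### Good samples and the accuracy of the learned target -/

theorem sum_sqrt_le {k : ℕ} {c : Fin k → ℝ} (hc : ∀ i, 0 ≤ c i) :
    ∑ i, √(c i) ≤ √(k * ∑ i, c i) := by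
  have := Real.sum_sqrt_mul_sqrt_le Finset.univ hc (g := fun _ => (1 : ℝ)) fun _ => zero_le_one
  simp only [Real.sqrt_one, mul_one, Finset.sum_const, Finset.card_univ, Fintype.card_fin,
    nsmul_eq_mul] at this
  rwa [← Real.sqrt_mul (Finset.sum_nonneg fun i _ => hc i), mul_comm] at this

theorem learnBeta_ge : 84 ≤ learnBeta := by
  have h2 : (1.414 : ℝ) ≤ √2 := Real.le_sqrt_of_sq_le (by norm_num)
  have : (6.4946 : ℝ) ≤ 2 * √2 + 2 / 3 + 3 := by
    norm_num at h2 ⊢; linarith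
  have h3 : (6.4946 : ℝ) ^ 2 ≤ (2 * √2 + 2 / 3 + 3) ^ 2 := by gcongr
  unfold learnBeta
  norm_num at h3 ⊢; linarith

/-- The parameters of the two algorithms, with an initial threshold that is large enough for the
learning round. -/
structure Params (k N₀ : ℕ) (δ : ℝ) : Prop where
  pos : 0 < δ
  lt_one : δ < 1
  two_le : 2 ≤ (k : ℝ) / δ
  large : learnBeta * (k * Real.log (k / δ)) < N₀

section Params

variable {k N₀ : ℕ} {δ : ℝ}

theorem log_div_ge (h : 2 ≤ (k : ℝ) / δ) : 0.693 ≤ Real.log (k / δ) := by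
  have h2 := Real.log_two_gt_d9
  have := Real.log_le_log (by norm_num) h
  norm_num at h2 ⊢; linarith

theorem Params.log_ge (h : Params k N₀ δ) : 0.693 ≤ Real.log (k / δ) := log_div_ge h.two_le

theorem pos_of_two_le_div (h0 : 0 < δ) (h : 2 ≤ (k : ℝ) / δ) : 0 < k := by
  rw [le_div_iff₀ h0] at h
  have : (0 : ℝ) < k := by linarith
  exact_mod_cast this

theorem Params.k_pos (h : Params k N₀ δ) : 0 < k := pos_of_two_le_div h.pos h.two_le

theorem Params.exp_neg_log (h : Params k N₀ δ) : Real.exp (-Real.log (k / δ)) = δ / k := by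
  have hk : (0 : ℝ) < k := by exact_mod_cast h.k_pos
  rw [Real.exp_neg, Real.exp_log (div_pos hk h.pos), inv_div]

theorem Params.log_three_le (h : Params k N₀ δ) : Real.log (3 / δ) ≤ 3 * Real.log (k / δ) := by
  have h1 : (1 : ℝ) ≤ k := by exact_mod_cast h.k_pos
  have hd := h.pos
  rw [show (3 : ℝ) * Real.log (k / δ) = Real.log ((k / δ) ^ 3) by rw [Real.log_pow]; norm_num]
  refine Real.log_le_log (by positivity) ?_
  have h2 := h.two_le
  have h3 : 3 / δ ≤ (k / δ) * 3 := by
    rw [div_mul_eq_mul_div]; gcongr; linarith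
  have h4 : 0 < (k : ℝ) / δ := by linarith
  nlinarith [mul_le_mul h2 h2 (by norm_num) h4.le]

theorem Params.log_three_nonneg (h : Params k N₀ δ) : 0 ≤ Real.log (3 / δ) := by
  refine Real.log_nonneg ?_
  rw [le_div_iff₀ h.pos]; linarith [h.lt_one]

theorem Params.kL_ge (h : Params k N₀ δ) : 0.693 ≤ k * Real.log (k / δ) := by
  have h1 : (1 : ℝ) ≤ k := by exact_mod_cast h.k_pos
  nlinarith [h.log_ge]

theorem Params.kL_ge' (h : Params k N₀ δ) : 0.693 * k ≤ k * Real.log (k / δ) := by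
  have h1 : (1 : ℝ) ≤ k := by exact_mod_cast h.k_pos
  nlinarith [h.log_ge]

theorem Params.kL_lt (h : Params k N₀ δ) {N : ℕ} (hN : learnBeta * (k * Real.log (k / δ)) < N) :
    84 * (k * Real.log (k / δ)) < N :=
  lt_of_le_of_lt (by gcongr; · linarith [h.kL_ge]
                     · exact learnBeta_ge) hN

end Params

/-- The counters `n` of the learning round are such that no player with a noticeable share of the
items is severely underestimated. -/
structure GoodSample {k : ℕ} (δ : ℝ) (N₀ : ℕ) (μ : Fin k → ℝ) (n : Fin k → ℕ) : Prop
    extends Params k N₀ δ where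
  nonneg : ∀ i, 0 ≤ μ i
  sum_eq : ∑ i, μ i = 1
  total_ge : 2 / 5 * N₀ ≤ total n
  le : ∀ i, μ i * total n ≤ n i + 3 * √(μ i * N₀ * Real.log (k / δ)) + 3 * Real.log (k / δ)

section GoodSample

variable {k N₀ : ℕ} {δ : ℝ} {μ : Fin k → ℝ} {n : Fin k → ℕ}

theorem GoodSample.N₀_pos (h : GoodSample δ N₀ μ n) : (0 : ℝ) < N₀ := by
  linarith [h.kL_lt h.large, h.kL_ge]

theorem GoodSample.total_pos (h : GoodSample δ N₀ μ n) : 0 < total n := by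
  linarith [h.N₀_pos, h.total_ge]

theorem GoodSample.sum_muBar (h : GoodSample δ N₀ μ n) : ∑ i, muBar n i = 1 := by
  unfold muBar
  rw [← Finset.sum_div]
  exact div_self h.total_pos.ne'

theorem GoodSample.muBar_nonneg (h : GoodSample δ N₀ μ n) (i : Fin k) : 0 ≤ muBar n i :=
  div_nonneg (Nat.cast_nonneg _) h.total_pos.le

theorem GoodSample.muBar_le_muHat (h : GoodSample δ N₀ μ n) (i : Fin k) :
    muBar n i ≤ muHat δ n i := by
  have h1 := h.log_three_nonneg
  have h2 := h.total_pos
  have : 0 ≤ 3 * Real.log (3 / δ) / total n := by positivity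
  unfold muHat
  linarith [Real.sqrt_nonneg (2 * (muBar n i - muBar n i ^ 2) * Real.log (3 / δ) / total n)]

theorem GoodSample.muHat_nonneg (h : GoodSample δ N₀ μ n) (i : Fin k) : 0 ≤ muHat δ n i :=
  (h.muBar_nonneg i).trans (h.muBar_le_muHat i)

theorem GoodSample.one_le_sigmaHat (h : GoodSample δ N₀ μ n) : 1 ≤ sigmaHat δ n := by
  rw [← h.sum_muBar]
  exact Finset.sum_le_sum fun i _ => h.muBar_le_muHat i

theorem GoodSample.sqrt_N_ge (h : GoodSample δ N₀ μ n) {N : ℕ}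
    (hN : learnBeta * (k * Real.log (k / δ)) < N) : 9.16 * √(k * Real.log (k / δ)) ≤ √N := by
  refine Real.le_sqrt_of_sq_le ?_
  rw [mul_pow, Real.sq_sqrt (by linarith [h.kL_ge])]
  have := h.kL_lt hN
  have := h.kL_ge
  norm_num at *; linarith

/-- The empirical frequencies sum to 1, so the excess is the sum of the confidence radii.
Cauchy–Schwarz bounds the sum of the square roots, and log (3 / δ) ≤ 3 log (k / δ). -/
theorem GoodSample.sigmaHat_le (h : GoodSample δ N₀ μ n) :
    (sigmaHat δ n - 1) * √N₀ ≤ 7 * √(k * Real.log (k / δ)) := by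
  have hw := h.total_pos
  have hN := h.N₀_pos
  have hz : 0 < √(N₀ : ℝ) := Real.sqrt_pos.2 hN
  have hz2 : √(N₀ : ℝ) ^ 2 = N₀ := Real.sq_sqrt hN.le
  have h3 := h.log_three_nonneg
  have hb := h.log_three_le
  have hkL := h.kL_ge
  have hL0 : 0 ≤ Real.log (k / δ) := by linarith [h.log_ge]
  have hy2 : √(k * Real.log (k / δ)) ^ 2 = k * Real.log (k / δ) := Real.sq_sqrt (by linarith)
  have hge := h.sqrt_N_ge h.large
  set y := √(k * Real.log (k / δ)) with hy
  have hy0 : 0 ≤ y := Real.sqrt_nonneg _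
  set z := √(N₀ : ℝ) with hzdef
  have hw1 : 2 / 5 * z ^ 2 ≤ total n := by rw [hz2]; exact h.total_ge
  have hsum : sigmaHat δ n - 1 = ∑ i, √(2 * (muBar n i - muBar n i ^ 2) * Real.log (3 / δ) / total n)
      + k * (3 * Real.log (3 / δ) / total n) := by
    unfold sigmaHat muHat
    rw [Finset.sum_add_distrib, Finset.sum_add_distrib, h.sum_muBar]
    simp only [Finset.sum_const, Finset.card_univ, Fintype.card_fin, nsmul_eq_mul]
    ring
  have h1 : k * (3 * Real.log (3 / δ) / total n) ≤ 45 / 2 * y ^ 2 / z ^ 2 := by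
    calc k * (3 * Real.log (3 / δ) / total n) ≤ k * (3 * (3 * Real.log (k / δ)) / (2 / 5 * z ^ 2)) := by
          gcongr
      _ = 45 / 2 * y ^ 2 / z ^ 2 := by rw [hy2]; field_simp; ring
  have h2 : ∑ i, √(2 * (muBar n i - muBar n i ^ 2) * Real.log (3 / δ) / total n) ≤ 3.88 * y / z := by
    calc _ ≤ ∑ i, √(2 * muBar n i * Real.log (3 / δ) / total n) := by
          gcongr with i
          linarith [sq_nonneg (muBar n i)]
      _ ≤ √(k * ∑ i, 2 * muBar n i * Real.log (3 / δ) / total n) :=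
          sum_sqrt_le fun i => by have := h.muBar_nonneg i; positivity
      _ = √(k * (2 * Real.log (3 / δ) / total n)) := by
          congr 2
          rw [← Finset.sum_div, ← Finset.sum_mul, ← Finset.mul_sum, h.sum_muBar, mul_one]
      _ ≤ √(k * (2 * (3 * Real.log (k / δ)) / (2 / 5 * z ^ 2))) := by gcongr
      _ ≤ 3.88 * y / z := by
          refine Real.sqrt_le_iff.2 ⟨by positivity, ?_⟩
          rw [show (k : ℝ) * (2 * (3 * Real.log (k / δ)) / (2 / 5 * z ^ 2)) = 15 * y ^ 2 / z ^ 2 by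
            rw [hy2]; field_simp; ring, div_pow, mul_pow]
          gcongr
          norm_num
  calc (sigmaHat δ n - 1) * z ≤ (3.88 * y / z + 45 / 2 * y ^ 2 / z ^ 2) * z := by
        rw [hsum]; gcongr
    _ = 3.88 * y + 45 / 2 * y * (y / z) := by field_simp
    _ ≤ 3.88 * y + 45 / 2 * y * (1 / 9.16) := by
        have : y / z ≤ 1 / 9.16 := by rw [div_le_div_iff₀ hz (by norm_num)]; linarith
        gcongr
    _ ≤ 7 * y := by norm_num; linarith

theorem sqrt_two_bounds : 2.08 ≤ √2 + 2 / 3 ∧ √2 + 2 / 3 ≤ 2.082 := by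
  have h1 : (1.414 : ℝ) ≤ √2 := Real.le_sqrt_of_sq_le (by norm_num)
  have h2 : √2 ≤ 1.415 := Real.sqrt_le_iff.2 (by norm_num)
  constructor <;> norm_num at * <;> linarith

/-- The target of a round in terms of the square roots of its parameters. -/
theorem GoodSample.target_eq (h : GoodSample δ N₀ μ n) {N : ℕ} (hle : N ≤ N₀) :
    ∃ u : ℝ, 0.75 ≤ u ∧ u ≤ 1 ∧ (1 - u ^ 2) * √N ≤ 7 * √(k * Real.log (k / δ)) ∧
      target δ n N = N * u ^ 2 - (√2 + 2 / 3) * (√(k * Real.log (k / δ)) * √N * u) := by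
  have hs1 := h.one_le_sigmaHat
  have hs0 : 0 < sigmaHat δ n := by linarith
  have hle' := h.sigmaHat_le
  have hkL := h.kL_ge
  have hz9 := h.sqrt_N_ge h.large
  have hy : 0 < √(k * Real.log (k / δ)) := Real.sqrt_pos.2 (by linarith)
  have hz : 0 < √(N₀ : ℝ) := Real.sqrt_pos.2 h.N₀_pos
  have hzz : √(N : ℝ) ≤ √(N₀ : ℝ) := Real.sqrt_le_sqrt (by exact_mod_cast hle)
  have hu2 : (1 / √(sigmaHat δ n)) ^ 2 = 1 / sigmaHat δ n := by
    rw [div_pow, Real.sq_sqrt hs0.le, one_pow]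
  have hsle : sigmaHat δ n - 1 ≤ 0.77 := by
    by_contra! hc
    nlinarith
  refine ⟨1 / √(sigmaHat δ n), ?_, ?_, ?_, ?_⟩
  · rw [le_div_iff₀ (Real.sqrt_pos.2 hs0)]
    have : √(sigmaHat δ n) ≤ 1.331 := Real.sqrt_le_iff.2 ⟨by norm_num, by norm_num at *; linarith⟩
    norm_num at *; linarith
  · rw [div_le_one (Real.sqrt_pos.2 hs0)]
    exact Real.one_le_sqrt.2 hs1
  · rw [hu2]
    have h1 : 1 - 1 / sigmaHat δ n ≤ sigmaHat δ n - 1 := by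
      rw [one_sub_div hs0.ne', div_le_iff₀ hs0]; nlinarith
    calc (1 - 1 / sigmaHat δ n) * √N ≤ (sigmaHat δ n - 1) * √N₀ := by
          gcongr
      _ ≤ _ := hle'
  · unfold target
    rw [hu2]
    congr 1
    · ring
    · congr 1
      rw [show (k : ℝ) * (N / sigmaHat δ n) * Real.log (k / δ) =
        (k * Real.log (k / δ)) * N / sigmaHat δ n by ring, Real.sqrt_div (by positivity),
        Real.sqrt_mul (by linarith)]
      ring

/-- Put y = √(kL), z = √N, c = √2 + 2/3. The target is z²u² - c y z u, where dividing by `sigmaHat`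
loses z²(1 - u²) ≤ 7yz and the margin is at most 2.082yz. The switching constant enters through z ≥
9.16y. -/
theorem GoodSample.target_bounds (h : GoodSample δ N₀ μ n) {N : ℕ}
    (hN : learnBeta * (k * Real.log (k / δ)) < N) (hle : N ≤ N₀) :
    N / 3 ≤ target δ n N ∧ N - target δ n N ≤ 9.1 * (√(k * Real.log (k / δ)) * √N) ∧
      2.08 * (√(k * Real.log (k / δ)) * √N) ≤ N - target δ n N := by
  obtain ⟨u, hu1, hu2, hu3, ht⟩ := h.target_eq hle
  have hz := h.sqrt_N_ge hN
  have hz2 : √(N : ℝ) ^ 2 = N := Real.sq_sqrt (Nat.cast_nonneg _)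
  have hy : 0 ≤ √(k * Real.log (k / δ)) := Real.sqrt_nonneg _
  have hz0 : 0 ≤ √(N : ℝ) := Real.sqrt_nonneg _
  rw [ht]
  obtain ⟨hc1, hc2⟩ := sqrt_two_bounds
  generalize √(N : ℝ) = z at *
  rw [← hz2]
  generalize √(k * Real.log (k / δ)) = y at *
  generalize √2 + 2 / 3 = c at *
  have hyz : 0 ≤ y * z := by positivity
  have hcyz : c * (y * z * u) ≤ 2.082 * (y * z * u) := by
    gcongr
  refine ⟨?_, ?_, ?_⟩
  · have h1 : y * z * u ≤ z / 9.16 * z * u := by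
      gcongr
      rw [le_div_iff₀ (by norm_num)]; linarith
    have h2 : 0 ≤ z ^ 2 * (u ^ 2 - 2.082 / 9.16 * u - 1 / 3) := by
      refine mul_nonneg (sq_nonneg z) ?_
      norm_num at hu1 ⊢
      nlinarith
    have h3 : 2.082 * (z / 9.16 * z * u) = z ^ 2 * (2.082 / 9.16 * u) := by ring
    linarith
  · have h1 := mul_le_mul_of_nonneg_right hu3 hz0
    have h2 : y * z * u ≤ y * z := by nlinarith
    have h3 : (1 - u ^ 2) * z * z = z ^ 2 - z ^ 2 * u ^ 2 := by ring
    linarith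
  -- Decreasing u from 1 lowers z²u² by at least as much as it lowers the margin, because z(1 + u) ≥
  -- cy.
  · have h1 : 0 ≤ z * (1 - u) * (z * (1 + u) - c * y) := by
      refine mul_nonneg (mul_nonneg hz0 (by linarith)) ?_
      nlinarith
    have h2 : 2.08 * (y * z) ≤ c * (y * z) := by gcongr
    linarith [show z * (1 - u) * (z * (1 + u) - c * y) =
      z ^ 2 - z ^ 2 * u ^ 2 - c * (y * z) + c * (y * z * u) by ring]

theorem sq_sqrt_ratio (N N₀ : ℕ) : √(N / N₀ : ℝ) ^ 2 = N / N₀ := Real.sq_sqrt (by positivity)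

/-- The mean number of items of player `i` among `target` many exceeds its estimate by little. -/
theorem GoodSample.mul_target_le (h : GoodSample δ N₀ μ n) {N : ℕ}
    (hN : learnBeta * (k * Real.log (k / δ)) < N) (hle : N ≤ N₀) (i : Fin k) :
    μ i * target δ n N ≤ muHat δ n i * target δ n N +
      8 * √(N / N₀) * √(μ i * target δ n N * Real.log (k / δ)) +
      8 * √(N / N₀) ^ 2 * Real.log (k / δ) := by
  rw [sq_sqrt_ratio]
  obtain ⟨ht1, -, ht2⟩ := h.target_bounds hN hle
  have hL := h.log_ge
  have hL0 : 0 < Real.log (k / δ) := by linarith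
  have hN0 := h.N₀_pos
  have hw := h.total_pos
  have hyz : 0 ≤ √(k * Real.log (k / δ)) * √(N : ℝ) := by positivity
  have hNn : (0 : ℝ) ≤ N := Nat.cast_nonneg _
  set T := target δ n N with hT
  have hT0 : 0 ≤ T := by linarith
  have hTN : T ≤ N := by linarith
  have hμ := h.nonneg i
  set L := Real.log (k / δ) with hLdef
  have hTw : T / total n ≤ 5 / 2 * (N / N₀) := by
    calc T / total n ≤ N / (2 / 5 * N₀) := by
          gcongr
          exact h.total_ge
      _ = 5 / 2 * (N / N₀) := by field_simp
  have hs : T * √(μ i * N₀ * L) ≤ √(μ i * T * L) * √(N / N₀) * N₀ := by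
    have e1 : T * √(μ i * N₀ * L) = √(μ i * T * L) * √(T * N₀) := by
      rw [← Real.sqrt_mul (by positivity), show μ i * T * L * (T * N₀) = T ^ 2 * (μ i * N₀ * L) by ring,
        Real.sqrt_mul (sq_nonneg T), Real.sqrt_sq hT0]
    have e2 : √(N / N₀) * N₀ = √(N * N₀ : ℝ) := by
      rw [show (N : ℝ) * N₀ = N / N₀ * (N₀ : ℝ) ^ 2 by field_simp, Real.sqrt_mul (by positivity),
        Real.sqrt_sq hN0.le]
    rw [e1, mul_assoc (√(μ i * T * L)), e2]
    gcongr
  -- The undercount bound of the sample, rescaled from `total n` to T items. The quotient T / `total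
  -- n` is at most (5/2)ρ², which is why the errors carry powers of ρ.
  have key : μ i * T ≤ muBar n i * T + T / total n * (3 * √(μ i * N₀ * L) + 3 * L) := by
    have h1 := mul_le_mul_of_nonneg_left (h.le i) (show 0 ≤ T / total n by positivity)
    have e1 : T / total n * (μ i * total n) = μ i * T := by field_simp
    have e2 : T / total n * (n i) = muBar n i * T := by unfold muBar; ring
    rw [e1, add_assoc, mul_add, e2] at h1
    exact h1
  -- The confidence radius is discarded here.
  have h1 : muBar n i * T ≤ muHat δ n i * T := by gcongr; exact h.muBar_le_muHat i
  have h2 : T / total n * (3 * √(μ i * N₀ * L)) ≤ 15 / 2 * √(N / N₀) * √(μ i * T * L) := by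
    calc T / total n * (3 * √(μ i * N₀ * L)) = 3 * (T * √(μ i * N₀ * L)) / total n := by ring
      _ ≤ 3 * (√(μ i * T * L) * √(N / N₀) * N₀) / (2 / 5 * N₀) := by
          gcongr
          exact h.total_ge
      _ = _ := by field_simp; ring
  have h3 : T / total n * (3 * L) ≤ 5 / 2 * (N / N₀) * (3 * L) := by gcongr
  have h4 : 0 ≤ √(N / N₀ : ℝ) * √(μ i * T * L) := by positivity
  have h5 : 0 ≤ (N / N₀ : ℝ) * L := by positivity
  linarith

end GoodSample

/-! ### Tail bounds for a slack computed from an estimated mean -/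

section Analysis

variable {q τ h L ρ s : ℝ} {m : ℕ}

/-- By AM–GM, 8√(τL) ≤ τ/2 + 32L. In the application τ = μᵢt is the mean at the target, h = μ̂ᵢt its
estimate and ρ = √(N / N₀). -/
theorem half_sub_le (hτ : 0 ≤ τ) (hL : 0 ≤ L) (hρ0 : 0 ≤ ρ) (hρ : ρ ≤ 1)
    (hE : τ ≤ h + 8 * ρ * √(τ * L) + 8 * ρ ^ 2 * L) : τ / 2 - 40 * L ≤ h := by
  have h1 : √(τ * L) ≤ τ / 16 + 4 * L := by
    refine Real.sqrt_le_iff.2 ⟨by positivity, ?_⟩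
    nlinarith [sq_nonneg (τ / 16 - 4 * L)]
  have h2 : 8 * ρ * √(τ * L) ≤ 8 * 1 * √(τ * L) := by gcongr
  have h3 : 8 * ρ ^ 2 * L ≤ 8 * 1 ^ 2 * L := by gcongr
  linarith

/-- A player with static slack does not notify within a small fraction of the target. -/
theorem binTail_le_of_fraction (h0 : 0 ≤ q) (h1 : q ≤ 1) (hL : 0 ≤ L) (hh : 0 ≤ h) (hρ0 : 0 ≤ ρ)
    (hρ : ρ ≤ 1) (hτ : 0 ≤ τ) (hE : τ ≤ h + 8 * ρ * √(τ * L) + 8 * ρ ^ 2 * L)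
    (hm : m * q ≤ τ / 10000) (hs : h + 2 / 3 * L ≤ s) : binTail q m s ≤ Real.exp (-(2 * L)) := by
  refine (binTail_le_exp_four h0 h1 hm).trans (Real.exp_le_exp.2 ?_)
  have := half_sub_le hτ hL hρ0 hρ hE
  -- For τ ≤ 88L the part (2/3)L of the slack suffices, since 8/3 - 54 · 88/10000 ≥ 2; for larger τ
  -- the bound h ≥ τ/2 - 40L does.
  rcases le_total τ (88 * L) with hc | hc <;> linarith

theorem exp_neg_two_mul_le (hL : 0.693 ≤ L) : Real.exp (-(2 * L)) ≤ 0.99 * Real.exp (-L) := by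
  rw [show -(2 * L) = -L + -L by ring, Real.exp_add]
  gcongr
  rw [Real.exp_neg, inv_le_comm₀ (Real.exp_pos _) (by norm_num)]
  have := Real.add_one_le_exp L
  norm_num at *; linarith

/-- A lower bound of a static slack, in terms of `a = √τ` and `b = √L`. -/
theorem slack_ge_of_estimate {a b : ℝ} (ha : 0 < a) (hb : 0 < b) (hb9 : b ≤ 9 * a) (hρ0 : 0 ≤ ρ)
    (hρ : ρ ≤ 1 / 1000000) (hE : a ^ 2 ≤ h + 8 * ρ * (a * b) + 8 * ρ ^ 2 * b ^ 2) :
    a ^ 2 - 9 * (ρ * (a * b)) + √2 * (a * b) - 13 * (ρ * b ^ 2) + 2 / 3 * b ^ 2 ≤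
      h + √(2 * h * b ^ 2) + 2 / 3 * b ^ 2 := by
  have hρb0 : 0 ≤ ρ * b := by positivity
  have hρb : ρ * b ≤ 9 / 1000000 * a := by
    calc ρ * b ≤ 1 / 1000000 * (9 * a) := by gcongr
      _ = _ := by ring
  have hhlow : a * (a - 9 * (ρ * b)) ≤ h := by
    have : (ρ * b) * (ρ * b) ≤ (9 / 1000000 * a) * (ρ * b) := by gcongr
    have h2 : 0 ≤ a * (ρ * b) := by positivity
    linarith [show 8 * ρ ^ 2 * b ^ 2 = 8 * ((ρ * b) * (ρ * b)) by ring,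
      show 8 * ρ * (a * b) = 8 * (a * (ρ * b)) by ring,
      show (9 / 1000000 * a) * (ρ * b) = 9 / 1000000 * (a * (ρ * b)) by ring,
      show a * (a - 9 * (ρ * b)) = a ^ 2 - 9 * (a * (ρ * b)) by ring]
  have hc2 : √2 ^ 2 = (2 : ℝ) := Real.sq_sqrt (by norm_num)
  have hc3 : √2 ≤ 1.415 := Real.sqrt_le_iff.2 (by norm_num)
  have hpos : 0 ≤ a - 9 * (ρ * b) := by linarith
  have hsq : √2 * ((a - 9 * (ρ * b)) * b) ≤ √(2 * h * b ^ 2) := by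
    refine Real.le_sqrt_of_sq_le ?_
    rw [mul_pow, hc2, mul_pow, ← mul_assoc]
    gcongr
    refine le_trans ?_ hhlow
    rw [sq]; gcongr; linarith
  have hρbb0 : 0 ≤ ρ * b ^ 2 := by positivity
  have h3 : √2 * (ρ * b ^ 2) ≤ 1.415 * (ρ * b ^ 2) := by gcongr
  linarith [show √2 * ((a - 9 * (ρ * b)) * b) = √2 * (a * b) - 9 * (√2 * (ρ * b ^ 2)) by ring,
    show a * (a - 9 * (ρ * b)) = a ^ 2 - 9 * (ρ * (a * b)) by ring]

/-- A player with static slack does not notify shortly before the target. -/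
theorem binTail_le_of_near_target (h0 : 0 ≤ q) (h1 : q ≤ 1) (hL : 0.693 ≤ L) (hh : 0 ≤ h)
    (hρ0 : 0 ≤ ρ) (hρ : ρ ≤ 1 / 1000000) (hτ : 0 ≤ τ)
    (hE : τ ≤ h + 8 * ρ * √(τ * L) + 8 * ρ ^ 2 * L) (hm : m * q ≤ (1 - 216 * ρ) * τ)
    (hs : h + √(2 * h * L) + 2 / 3 * L ≤ s) : binTail q m s ≤ 0.99 * Real.exp (-L) := by
  have hL0 : 0 < L := by linarith
  have hmτ : m * q ≤ τ := hm.trans (mul_le_of_le_one_left hτ (by linarith))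
  -- With a tiny mean, (2/3)L alone suffices: 4 · 2/3 - 54/81 = 2.
  rcases le_or_gt τ (L / 81) with hc | hc
  · refine le_trans ?_ (exp_neg_two_mul_le hL)
    refine (binTail_le_exp_four h0 h1 hmτ).trans (Real.exp_le_exp.2 ?_)
    linarith [Real.sqrt_nonneg (2 * h * L)]
  have hτ0 : 0 < τ := by linarith
  obtain ⟨a, ha0, ha⟩ : ∃ a, 0 < a ∧ a ^ 2 = τ := ⟨√τ, Real.sqrt_pos.2 hτ0, Real.sq_sqrt hτ⟩
  obtain ⟨b, hb0, hb⟩ : ∃ b, 0 < b ∧ b ^ 2 = L := ⟨√L, Real.sqrt_pos.2 hL0, Real.sq_sqrt hL0.le⟩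
  have hab : √(τ * L) = a * b := by
    rw [← ha, ← hb, ← mul_pow, Real.sqrt_sq (by positivity)]
  have hb9 : b ≤ 9 * a := by
    refine (sq_le_sq₀ hb0.le (by positivity)).1 ?_
    rw [mul_pow, ha, hb]; linarith
  have hslow := (slack_ge_of_estimate ha0 hb0 hb9 hρ0 hρ (h := h)
    (by rw [ha, hb, ← hab]; exact hE)).trans
    (show h + √(2 * h * b ^ 2) + 2 / 3 * b ^ 2 ≤ s by rw [hb]; exact hs)
  have hab0 : 0 < a * b := by positivity
  have hρbb : ρ * b ^ 2 ≤ 1 / 1000000 * b ^ 2 := by gcongr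
  -- An estimation error of at most L/24 fits into the reserve 2/3 - 7/12 of the slack. A larger one
  -- forces √L ≤ 216ρ√τ (216 = 9 · 24); then stopping 216ρτ ≥ √(τL) short of the target leaves room
  -- for Bernstein's bound at level 2L.
  rcases le_or_gt (9 * (ρ * (a * b))) (b ^ 2 / 24) with hd | hd
  · refine binTail_lt_exp_neg h0 h1 hmτ hτ0 hL ?_
    rw [show 2 * τ * L = 2 * (τ * L) by ring, Real.sqrt_mul (by norm_num), hab, ← ha, ← hb]
    linarith [sq_nonneg b]
  · refine le_trans ?_ (exp_neg_two_mul_le hL)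
    have hbρ : b ≤ 216 * ρ * a := by
      refine le_of_mul_le_mul_right ?_ hb0
      linarith [show 216 * ρ * a * b = 216 * (ρ * (a * b)) by ring, show b * b = b ^ 2 by ring]
    have hτ1 : 0 < (1 - 216 * ρ) * τ := mul_pos (by linarith) hτ0
    refine binTail_le_exp_neg h0 h1 hm hτ1 (by linarith) ?_
    have h4 : √(2 * ((1 - 216 * ρ) * τ) * (2 * L)) ≤ 2 * (a * b) := by
      refine Real.sqrt_le_iff.2 ⟨by positivity, ?_⟩
      rw [← ha, ← hb]
      have : 0 ≤ ρ * (a ^ 2 * b ^ 2) := by positivity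
      linarith [show 2 * ((1 - 216 * ρ) * a ^ 2) * (2 * b ^ 2) =
        (2 * (a * b)) ^ 2 - 864 * (ρ * (a ^ 2 * b ^ 2)) by ring]
    have h5 : a * b ≤ a * (216 * ρ * a) := by gcongr
    have h6 : ρ * (b * b) ≤ 1 / 1000000 * (b * (9 * a)) := by gcongr
    have h7 : ρ * (a * b) ≤ 1 / 1000000 * (a * b) := by gcongr
    have h8 : 1.414 * (a * b) ≤ √2 * (a * b) := by
      gcongr
      exact Real.le_sqrt_of_sq_le (by norm_num)
    rw [← ha, ← hb] at h4 ⊢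
    linarith [show a * (216 * ρ * a) = 216 * ρ * a ^ 2 by ring, show ρ * (b * b) = ρ * b ^ 2 by ring]

end Analysis

/-! ### Failure probability of a round with learned slacks -/

section Rules

variable {k N₀ : ℕ} {δ : ℝ} {μ : Fin k → ℝ} {n : Fin k → ℕ}

/-- The numbers of items that a round with threshold `N` collects with good probability. -/
def Reachable {k : ℕ} (δ : ℝ) (N₀ : ℕ) (n : Fin k → ℕ) (N m : ℕ) : Prop :=
  (m : ℝ) ≤ target δ n N / 10000 ∨
    √(N / N₀ : ℝ) ≤ 1 / 1000000 ∧ (m : ℝ) ≤ (1 - 216 * √(N / N₀ : ℝ)) * target δ n N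

theorem GoodSample.target_nonneg (h : GoodSample δ N₀ μ n) {N : ℕ}
    (hN : learnBeta * (k * Real.log (k / δ)) < N) (hle : N ≤ N₀) : 0 ≤ target δ n N :=
  le_trans (by positivity) (h.target_bounds hN hle).1

theorem GoodSample.target_le (h : GoodSample δ N₀ μ n) {N : ℕ}
    (hN : learnBeta * (k * Real.log (k / δ)) < N) (hle : N ≤ N₀) : target δ n N ≤ N := by
  have h1 := (h.target_bounds hN hle).2.2
  have h2 : 0 ≤ √(k * Real.log (k / δ)) * √(N : ℝ) := by positivity
  linarith

theorem ratio_le_one {N : ℕ} (hle : N ≤ N₀) : √(N / N₀ : ℝ) ≤ 1 := by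
  refine Real.sqrt_le_one.2 (div_le_one_of_le₀ (by exact_mod_cast hle) (Nat.cast_nonneg _))

theorem GoodSample.le_one (h : GoodSample δ N₀ μ n) (i : Fin k) : μ i ≤ 1 := by
  rw [← h.sum_eq]
  exact Finset.single_le_sum (fun i _ => h.nonneg i) (Finset.mem_univ i)

theorem GoodSample.binTail_upperBound_le (h : GoodSample δ N₀ μ n) {N m : ℕ}
    (hN : learnBeta * (k * Real.log (k / δ)) < N) (hle : N ≤ N₀) (hm : Reachable δ N₀ n N m)
    (i : Fin k) : binTail (μ i) m (upperBound δ n N i) ≤ 0.99 * (δ / k) := by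
  rw [← h.exp_neg_log]
  have hT := h.target_nonneg hN hle
  have hμ := h.nonneg i
  have hE := h.mul_target_le hN hle i
  have hh : 0 ≤ muHat δ n i * target δ n N := mul_nonneg (h.muHat_nonneg i) hT
  have hL := h.log_ge
  have hs : upperBound δ n N i = muHat δ n i * target δ n N +
      √(2 * (muHat δ n i * target δ n N) * Real.log (k / δ)) + 2 / 3 * Real.log (k / δ) := by
    unfold upperBound
    ring_nf
  rcases hm with hm | ⟨hr, hm⟩
  · refine (binTail_le_of_fraction hμ (h.le_one i) (by linarith) hh (Real.sqrt_nonneg _)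
      (ratio_le_one hle) (mul_nonneg hμ hT) hE ?_ ?_).trans (exp_neg_two_mul_le hL)
    · nlinarith
    · rw [hs]; linarith [Real.sqrt_nonneg (2 * (muHat δ n i * target δ n N) * Real.log (k / δ))]
  · refine binTail_le_of_near_target hμ (h.le_one i) hL hh (Real.sqrt_nonneg _) hr
      (mul_nonneg hμ hT) hE ?_ hs.symm.le
    nlinarith

/-- The base values may undershoot the means, but in total by little against Q = √(kLN), the scale
of the dynamic slacks. A small fraction of the target exceeds a base value by at most 88L/10000 per
player; near the target, Cauchy–Schwarz gives about 8ρQ, with ρ ≤ 10⁻⁶. -/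
theorem GoodSample.mul_sub_le (h : GoodSample δ N₀ μ n) {N m : ℕ}
    (hN : learnBeta * (k * Real.log (k / δ)) < N) (hle : N ≤ N₀) (hm : Reachable δ N₀ n N m)
    (A : Finset (Fin k)) : ∑ i ∈ A, (μ i * m - muHat δ n i * target δ n N) ≤
      0.02 * (√(k * Real.log (k / δ)) * √N) := by
  have hT := h.target_nonneg hN hle
  have hTN := h.target_le hN hle
  have hL := h.log_ge
  have hL0 : 0 ≤ Real.log (k / δ) := by linarith
  have hz := h.sqrt_N_ge hN
  have hy2 : √(k * Real.log (k / δ)) ^ 2 = k * Real.log (k / δ) := Real.sq_sqrt (by linarith [h.kL_ge])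
  have hy0 : 0 ≤ √(k * Real.log (k / δ)) := Real.sqrt_nonneg _
  have hkLQ : k * Real.log (k / δ) ≤ √(k * Real.log (k / δ)) * √N / 9 := by
    nlinarith
  have hQ : 0 ≤ √(k * Real.log (k / δ)) * √(N : ℝ) := by positivity
  rcases hm with hm | ⟨hr, hm⟩
  · calc ∑ i ∈ A, (μ i * m - muHat δ n i * target δ n N)
        ≤ ∑ i ∈ A, 0.0088 * Real.log (k / δ) := by
          refine Finset.sum_le_sum fun i _ => ?_
          have hE := h.mul_target_le hN hle i
          have h1 := half_sub_le (mul_nonneg (h.nonneg i) hT) hL0 (Real.sqrt_nonneg _)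
            (ratio_le_one hle) hE
          have h2 : μ i * m ≤ μ i * target δ n N / 10000 := by nlinarith [h.nonneg i]
          have h3 := mul_nonneg (h.muHat_nonneg i) hT
          norm_num
          rcases le_total (μ i * target δ n N) (88 * Real.log (k / δ)) with hc | hc <;> linarith
      _ ≤ ∑ i : Fin k, 0.0088 * Real.log (k / δ) :=
          Finset.sum_le_sum_of_subset_of_nonneg (Finset.subset_univ _) fun _ _ _ => by positivity
      _ = 0.0088 * (k * Real.log (k / δ)) := by simp; ring
      _ ≤ _ := by linarith
  · set ρ := √(N / N₀ : ℝ) with hρ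
    have hρ0 : 0 ≤ ρ := Real.sqrt_nonneg _
    calc ∑ i ∈ A, (μ i * m - muHat δ n i * target δ n N)
        ≤ ∑ i ∈ A, (8 * ρ * √(μ i * target δ n N * Real.log (k / δ)) +
            8 * ρ ^ 2 * Real.log (k / δ)) := by
          refine Finset.sum_le_sum fun i _ => ?_
          have hE := h.mul_target_le hN hle i
          have h2 : μ i * m ≤ μ i * target δ n N := by
            refine mul_le_mul_of_nonneg_left (hm.trans ?_) (h.nonneg i)
            nlinarith
          linarith
      _ ≤ ∑ i : Fin k, (8 * ρ * √(μ i * target δ n N * Real.log (k / δ)) +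
            8 * ρ ^ 2 * Real.log (k / δ)) :=
          Finset.sum_le_sum_of_subset_of_nonneg (Finset.subset_univ _) fun _ _ _ => by positivity
      _ = 8 * ρ * ∑ i : Fin k, √(μ i * target δ n N * Real.log (k / δ)) +
            8 * ρ ^ 2 * (k * Real.log (k / δ)) := by
          rw [Finset.sum_add_distrib, ← Finset.mul_sum]; simp; ring
      _ ≤ 8 * ρ * (√(k * Real.log (k / δ)) * √N) + 8 * ρ ^ 2 * (k * Real.log (k / δ)) := by
          gcongr
          refine (sum_sqrt_le fun i => mul_nonneg (mul_nonneg (h.nonneg i) hT) hL0).trans ?_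
          rw [← Finset.sum_mul, ← Finset.sum_mul, h.sum_eq, one_mul, ← Real.sqrt_mul (by positivity)]
          refine Real.sqrt_le_sqrt ?_
          calc (k : ℝ) * (target δ n N * Real.log (k / δ))
              ≤ k * (N * Real.log (k / δ)) := by gcongr
            _ = _ := by ring
      _ ≤ 8 * (1 / 1000000) * (√(k * Real.log (k / δ)) * √N) +
            8 * (1 / 1000000) ^ 2 * (√(k * Real.log (k / δ)) * √N / 9) := by gcongr
      _ ≤ _ := by linarith

/-- (N - t)/2 is at least 1.04Q, and rounding down costs at most k < 0.16Q. -/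
theorem GoodSample.slack_ge (h : GoodSample δ N₀ μ n) {N : ℕ}
    (hN : learnBeta * (k * Real.log (k / δ)) < N) (hle : N ≤ N₀) :
    0.88 * (√(k * Real.log (k / δ)) * √N) ≤ k * (⌊((N : ℝ) - target δ n N) / (2 * k)⌋₊ : ℝ) := by
  have hk : (0 : ℝ) < k := by exact_mod_cast h.k_pos
  have h1 := (h.target_bounds hN hle).2.2
  have hz := h.sqrt_N_ge hN
  have hkL := h.kL_ge'
  have hy2 : √(k * Real.log (k / δ)) ^ 2 = k * Real.log (k / δ) := Real.sq_sqrt (by linarith [h.kL_ge])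
  have hy0 : 0 ≤ √(k * Real.log (k / δ)) := Real.sqrt_nonneg _
  have h2 := Nat.lt_floor_add_one (((N : ℝ) - target δ n N) / (2 * k))
  have h3 : (N - target δ n N) / 2 ≤ k * (⌊((N : ℝ) - target δ n N) / (2 * k)⌋₊ + 1) := by
    calc (N - target δ n N) / 2 = k * ((N - target δ n N) / (2 * k)) := by field_simp
      _ ≤ _ := by gcongr
  have h4 : 9.16 * (k * Real.log (k / δ)) ≤ √(k * Real.log (k / δ)) * √N := by
    have := mul_le_mul_of_nonneg_left hz hy0
    linarith [show √(k * Real.log (k / δ)) * (9.16 * √(k * Real.log (k / δ))) =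
      9.16 * √(k * Real.log (k / δ)) ^ 2 by ring]
  linarith

theorem GoodSample.slack_pos (h : GoodSample δ N₀ μ n) {N : ℕ}
    (hN : learnBeta * (k * Real.log (k / δ)) < N) (hle : N ≤ N₀) :
    0 < ⌊((N : ℝ) - target δ n N) / (2 * k)⌋₊ := by
  have h1 := h.slack_ge hN hle
  have hz := h.sqrt_N_ge hN
  have hy : 0 < √(k * Real.log (k / δ)) := Real.sqrt_pos.2 (by linarith [h.kL_ge])
  have hz0 : 0 < √(N : ℝ) := lt_of_lt_of_le (by positivity) hz
  by_contra! hc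
  have hc0 : ⌊((N : ℝ) - target δ n N) / (2 * k)⌋₊ = 0 := by omega
  rw [hc0] at h1
  have : 0 < √(k * Real.log (k / δ)) * √(N : ℝ) := by positivity
  rw [Nat.cast_zero, mul_zero] at h1
  linarith

theorem GoodSample.staticRule_exists_endsAt (h : GoodSample δ N₀ μ n) (N : ℕ) (a : ℕ → Fin k)
    (p : ℕ) : ∃ m, (learnedStaticRule δ n N).EndsAt a p m := by
  refine RoundRule.exists_endsAt h.k_pos ⟨∑ i, ⌈upperBound δ n N i⌉₊, fun i j hj => ?_⟩ a p
  have h1 : ⌈upperBound δ n N i⌉₊ ≤ j :=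
    (Finset.single_le_sum (f := fun i => ⌈upperBound δ n N i⌉₊) (fun _ _ => Nat.zero_le _)
      (Finset.mem_univ i)).trans hj
  simp [learnedStaticRule, staticRule, Nat.ceil_le.1 h1]

theorem GoodSample.dynamicRule_exists_endsAt (h : GoodSample δ N₀ μ n) {N : ℕ}
    (hN : learnBeta * (k * Real.log (k / δ)) < N) (hle : N ≤ N₀) (a : ℕ → Fin k) (p : ℕ) :
    ∃ m, (learnedDynamicRule δ n N).EndsAt a p m := by
  have hs := h.slack_pos hN hle
  simp only [learnedDynamicRule]
  set s := ⌊((N : ℝ) - target δ n N) / (2 * k)⌋₊ with hsdef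
  have hs' : (0 : ℝ) < s := by exact_mod_cast hs
  refine RoundRule.exists_endsAt h.k_pos
    ⟨k * s + ∑ i, ⌈muHat δ n i * target δ n N⌉₊, fun i j hj => ?_⟩ a p
  have h1 : ⌈muHat δ n i * target δ n N⌉₊ ≤ ∑ i, ⌈muHat δ n i * target δ n N⌉₊ :=
    Finset.single_le_sum (f := fun i => ⌈muHat δ n i * target δ n N⌉₊) (fun _ _ => Nat.zero_le _)
      (Finset.mem_univ i)
  have h2 := Nat.le_ceil (muHat δ n i * target δ n N)
  have h3 : ((k * s + ⌈muHat δ n i * target δ n N⌉₊ : ℕ) : ℝ) ≤ j := by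
    exact_mod_cast (by omega : k * s + ⌈muHat δ n i * target δ n N⌉₊ ≤ j)
  push_cast at h3
  refine Nat.le_floor ?_
  rw [le_div_iff₀ hs']
  simp only [dynamicRule]
  linarith

theorem GoodSample.staticRule_not_endsAt_zero (h : GoodSample δ N₀ μ n) {N : ℕ}
    (hN : learnBeta * (k * Real.log (k / δ)) < N) (hle : N ≤ N₀) (a : ℕ → Fin k) (p : ℕ) :
    ¬ (learnedStaticRule δ n N).EndsAt a p 0 := by
  rw [RoundRule.endsAt_iff]
  have hT := h.target_nonneg hN hle
  have : ∀ i, 0 < upperBound δ n N i := fun i => by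
    have h1 := mul_nonneg (h.muHat_nonneg i) hT
    have h2 := h.log_ge
    unfold upperBound
    have h3 := Real.sqrt_nonneg (2 * target δ n N * muHat δ n i * Real.log (k / δ))
    linarith
  simp [learnedStaticRule, staticRule, counter, this]

theorem GoodSample.dynamicRule_not_endsAt_zero (h : GoodSample δ N₀ μ n) {N : ℕ}
    (hN : learnBeta * (k * Real.log (k / δ)) < N) (hle : N ≤ N₀) (a : ℕ → Fin k) (p : ℕ) :
    ¬ (learnedDynamicRule δ n N).EndsAt a p 0 := by
  rw [RoundRule.endsAt_iff]
  have hT := h.target_nonneg hN hle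
  have : ∀ i, ⌊((0 : ℝ) - muHat δ n i * target δ n N) /
      (⌊((N : ℝ) - target δ n N) / (2 * k)⌋₊ : ℝ)⌋₊ = 0 := fun i => by
    refine Nat.floor_of_nonpos (div_nonpos_of_nonpos_of_nonneg ?_ (Nat.cast_nonneg _))
    linarith [mul_nonneg (h.muHat_nonneg i) hT]
  have hk := h.k_pos
  simp only [learnedDynamicRule, dynamicRule, counter]
  simp only [Finset.range_zero, Finset.filter_empty, Finset.card_empty, Nat.cast_zero, this,
    Finset.sum_const_zero]
  omega

variable {Ω : Type*} [MeasurableSpace Ω] {P : Measure Ω} [IsProbabilityMeasure P]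
  {X : ℕ → Ω → Fin k}

theorem GoodSample.measureReal_static_le (h : GoodSample δ N₀ μ n) (hX : IsItemStream P X μ)
    {N m : ℕ} (hN : learnBeta * (k * Real.log (k / δ)) < N) (hle : N ≤ N₀)
    (hm : Reachable δ N₀ n N m) (p : ℕ) :
    P.real {ω | ∃ m' < m, (learnedStaticRule δ n N).EndsAt (fun j => X j ω) p m'} ≤ 0.99 * δ := by
  have hk : (0 : ℝ) < k := by exact_mod_cast h.k_pos
  have hsub : {ω | ∃ m' < m, (learnedStaticRule δ n N).EndsAt (fun j => X j ω) p m'} ⊆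
      ⋃ i ∈ (Finset.univ : Finset (Fin k)),
        {ω | upperBound δ n N i ≤ setCount (fun j => X j ω) p m {i}} := by
    rintro ω ⟨m', hm', hend⟩
    have h1 := (RoundRule.endsAt_iff.1 hend).1
    simp only [learnedStaticRule, staticRule] at h1
    obtain ⟨i, -, hi⟩ := Finset.exists_ne_zero_of_sum_ne_zero (by omega : ∑ i : Fin k,
      (if upperBound δ n N i ≤ (counter (fun j => X j ω) p m' i : ℝ) then 1 else 0) ≠ 0)
    have hi' : upperBound δ n N i ≤ (counter (fun j => X j ω) p m' i : ℝ) := by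
      by_contra hc; simp [hc] at hi
    refine Set.mem_biUnion (Finset.mem_univ i) ?_
    simp only [Set.mem_ofPred_eq, ← counter_eq_setCount]
    exact hi'.trans (by exact_mod_cast counter_mono _ _ hm'.le i)
  calc _ ≤ _ := measureReal_mono hsub (measure_ne_top _ _)
    _ ≤ ∑ i : Fin k, P.real {ω | upperBound δ n N i ≤ setCount (fun j => X j ω) p m {i}} :=
        measureReal_biUnion_finset_le _ _
    _ ≤ ∑ i : Fin k, 0.99 * (δ / k) := by
        refine Finset.sum_le_sum fun i _ => ?_
        rw [hX.measureReal_setCount, Finset.sum_singleton]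
        exact h.binTail_upperBound_le hN hle hm i
    _ = 0.99 * δ := by simp; field_simp

/-- The exponential is (δ/k)^(1.4792k). For k ≥ 2 the power of k absorbs 2^k. For k = 1 it cannot;
there the omission of the empty set (2^k - 1 = 1) matters, and δ ≤ 1/2 gives the factor 0.99. -/
theorem Params.two_pow_mul_exp_le (h : Params k N₀ δ) :
    (2 ^ k - 1) * Real.exp (-(1.4792 * (k * Real.log (k / δ)))) ≤ 0.99 * δ := by
  have hk0 := h.k_pos
  have hkr : (0 : ℝ) < k := by exact_mod_cast hk0
  have hL := h.log_ge
  have hδ := h.pos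
  have small : ∀ x : ℝ, 0.3 ≤ x → Real.exp (-x) ≤ 0.99 := fun x hx => by
    rw [Real.exp_neg, inv_le_comm₀ (Real.exp_pos _) (by norm_num)]
    have := Real.add_one_le_exp x
    norm_num at *; linarith
  rcases Nat.lt_or_ge k 2 with h2 | h2
  · have hk1 : k = 1 := by omega
    subst hk1
    have he : Real.exp (-Real.log (((1 : ℕ) : ℝ) / δ)) = δ := by
      rw [h.exp_neg_log]; simp
    have : Real.exp (-(1.4792 * (((1 : ℕ) : ℝ) * Real.log (((1 : ℕ) : ℝ) / δ)))) =
        Real.exp (-(0.4792 * Real.log (((1 : ℕ) : ℝ) / δ))) * δ := by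
      nth_rewrite 3 [← he]
      rw [← Real.exp_add]; congr 1; push_cast; ring
    rw [this]
    have h3 := small (0.4792 * Real.log (((1 : ℕ) : ℝ) / δ)) (by norm_num at *; linarith)
    norm_num at h3 ⊢
    gcongr
  · have hk2 : (2 : ℝ) ≤ k := by exact_mod_cast h2
    have hlog : Real.log (k / δ) = Real.log k - Real.log δ := Real.log_div hkr.ne' hδ.ne'
    have hlogk : Real.log 2 ≤ Real.log k := Real.log_le_log (by norm_num) hk2
    have hlogδ : Real.log δ ≤ 0 := Real.log_nonpos hδ.le h.lt_one.le
    have hl2 := Real.log_two_gt_d9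
    calc (2 ^ k - 1) * Real.exp (-(1.4792 * (k * Real.log (k / δ))))
        ≤ 2 ^ k * Real.exp (-(1.4792 * (k * Real.log (k / δ)))) := by
          gcongr; linarith
      _ = Real.exp (k * Real.log 2 - 1.4792 * (k * Real.log (k / δ))) := by
          rw [sub_eq_add_neg, Real.exp_add, Real.exp_nat_mul, Real.exp_log (by norm_num)]
      _ ≤ Real.exp (-0.3 + Real.log δ) := by
          refine Real.exp_le_exp.2 ?_
          rw [hlog]
          have e1 : (k : ℝ) * Real.log 2 ≤ k * Real.log k := by gcongr
          have e2 : 2 * Real.log 2 ≤ k * Real.log k := by gcongr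
          have e3 : (k : ℝ) * Real.log δ ≤ 1 * Real.log δ :=
            mul_le_mul_of_nonpos_right (by linarith) hlogδ
          norm_num at *
          linarith
      _ = Real.exp (-0.3) * δ := by rw [Real.exp_add, Real.exp_log hδ]
      _ ≤ 0.99 * δ := by gcongr; exact small 0.3 le_rfl

/-- If k notifications have been sent, the players above their base values form a nonempty set A
whose counters exceed the base values by at least ks ≥ 0.88Q in total. So A has received at least
(0.88 - 0.02)Q items more than its mean. As A is random, Hoeffding's inequality is summed over all
nonempty sets; 2 · 0.86² = 1.4792. -/
theorem GoodSample.measureReal_dynamic_le (h : GoodSample δ N₀ μ n) (hX : IsItemStream P X μ)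
    {N m : ℕ} (hN : learnBeta * (k * Real.log (k / δ)) < N) (hle : N ≤ N₀)
    (hm : Reachable δ N₀ n N m) (p : ℕ) :
    P.real {ω | ∃ m' < m, (learnedDynamicRule δ n N).EndsAt (fun j => X j ω) p m'} ≤ 0.99 * δ := by
  have hk : (0 : ℝ) < k := by exact_mod_cast h.k_pos
  have hslack := h.slack_ge hN hle
  have hspos := h.slack_pos hN hle
  have hT := h.target_nonneg hN hle
  have hTN := h.target_le hN hle
  have hkL := h.kL_ge
  have hN0 : (0 : ℝ) < N := by linarith [h.kL_lt hN]
  have hQ2 : (√(k * Real.log (k / δ)) * √(N : ℝ)) ^ 2 = k * Real.log (k / δ) * N := by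
    rw [mul_pow, Real.sq_sqrt (by linarith), Real.sq_sqrt hN0.le]
  have hbase := h.mul_sub_le hN hle hm
  have hQ : 0 < √(k * Real.log (k / δ)) * √(N : ℝ) := by
    have := Real.sqrt_pos.2 (show 0 < k * Real.log (k / δ) by linarith)
    positivity
  set Q := √(k * Real.log (k / δ)) * √(N : ℝ) with hQdef
  have hmN : (m : ℝ) ≤ N := by
    rcases hm with hm | ⟨hr, hm⟩
    · linarith
    · have := Real.sqrt_nonneg (N / N₀ : ℝ)
      nlinarith
  set s := ⌊((N : ℝ) - target δ n N) / (2 * k)⌋₊ with hs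
  have hs' : (0 : ℝ) < s := by exact_mod_cast hspos
  have hsub : {ω | ∃ m' < m, (learnedDynamicRule δ n N).EndsAt (fun j => X j ω) p m'} ⊆
      ⋃ A ∈ (Finset.univ : Finset (Finset (Fin k))).erase ∅,
        {ω | m * (∑ i ∈ A, μ i) + 0.86 * Q ≤ setCount (fun j => X j ω) p m A} := by
    rintro ω ⟨m', hm', hend⟩
    have h1 := (RoundRule.endsAt_iff.1 hend).1
    simp only [learnedDynamicRule, dynamicRule, ← hs] at h1
    set c := counter (fun j => X j ω) p m' with hc
    let b : Fin k → ℝ := fun i => muHat δ n i * target δ n N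
    let A : Finset (Fin k) := Finset.univ.filter fun i => b i < c i
    have h2 : (k : ℝ) * s ≤ ∑ i ∈ A, ((c i : ℝ) - b i) := by
      have h3 : (k : ℝ) ≤ ∑ i, (⌊((c i : ℝ) - b i) / s⌋₊ : ℝ) := by exact_mod_cast h1
      have h4 : ∑ i, (⌊((c i : ℝ) - b i) / s⌋₊ : ℝ) = ∑ i ∈ A, (⌊((c i : ℝ) - b i) / s⌋₊ : ℝ) := by
        symm
        refine Finset.sum_subset (Finset.subset_univ _) fun i _ hi => ?_
        have : ((c i : ℝ) - b i) ≤ 0 := by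
          simp only [A, Finset.mem_filter, Finset.mem_univ, true_and, not_lt] at hi
          linarith
        rw [Nat.floor_of_nonpos (div_nonpos_of_nonpos_of_nonneg this hs'.le), Nat.cast_zero]
      have h5 : ∑ i ∈ A, (⌊((c i : ℝ) - b i) / s⌋₊ : ℝ) ≤ ∑ i ∈ A, ((c i : ℝ) - b i) / s := by
        refine Finset.sum_le_sum fun i hi => Nat.floor_le ?_
        simp only [A, Finset.mem_filter, Finset.mem_univ, true_and] at hi
        exact div_nonneg (by linarith) hs'.le
      rw [← Finset.sum_div] at h5
      rw [← le_div_iff₀ hs']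
      linarith
    have hA : A ≠ ∅ := by
      intro hA
      rw [hA, Finset.sum_empty] at h2
      have : 0 < (k : ℝ) * s := by positivity
      linarith
    refine Set.mem_biUnion (Finset.mem_erase.2 ⟨hA, Finset.mem_univ A⟩) ?_
    have h6 : ∑ i ∈ A, (c i : ℝ) ≤ setCount (fun j => X j ω) p m A := by
      rw [setCount_eq_sum]
      push_cast
      exact Finset.sum_le_sum fun i _ => by exact_mod_cast counter_mono _ _ hm'.le i
    have h7 := hbase A
    rw [Finset.sum_sub_distrib] at h2 h7
    rw [← Finset.sum_mul] at h7
    simp only [Set.mem_ofPred_eq]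
    norm_num at h7 hslack ⊢
    linarith
  calc _ ≤ _ := measureReal_mono hsub (measure_ne_top _ _)
    _ ≤ ∑ A ∈ (Finset.univ : Finset (Finset (Fin k))).erase ∅,
        P.real {ω | m * (∑ i ∈ A, μ i) + 0.86 * Q ≤ setCount (fun j => X j ω) p m A} :=
        measureReal_biUnion_finset_le _ _
    _ ≤ ∑ A ∈ (Finset.univ : Finset (Finset (Fin k))).erase ∅,
        Real.exp (-(1.4792 * (k * Real.log (k / δ)))) := by
        refine Finset.sum_le_sum fun A _ => ?_
        rw [hX.measureReal_setCount]
        refine (binTail_le_hoeffding (Finset.sum_nonneg fun i _ => h.nonneg i) (hX.sum_le_one A)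
          hmN hN0 (by positivity)).trans (Real.exp_le_exp.2 ?_)
        rw [mul_pow, hQ2]
        have : 2 * (0.86 ^ 2 * (k * Real.log (k / δ) * N)) / (N : ℝ) =
            1.4792 * (k * Real.log (k / δ)) := by field_simp; ring
        rw [this]
    _ = (2 ^ k - 1) * Real.exp (-(1.4792 * (k * Real.log (k / δ)))) := by
        rw [Finset.sum_const, Finset.card_erase_of_mem (Finset.mem_univ _), nsmul_eq_mul]
        congr 1
        simp [Nat.cast_sub (Nat.one_le_two_pow)]
    _ ≤ _ := h.two_pow_mul_exp_le

end Rules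

/-! ### The learning round yields a good sample -/

section Learning

/-- The product with 1 + θ + θ²/2 ≤ e^θ is 1 + θ⁴/4. -/
theorem exp_neg_le_quadratic {θ : ℝ} (hθ : 0 ≤ θ) : Real.exp (-θ) ≤ 1 - θ + θ ^ 2 / 2 := by
  have h1 := Real.quadratic_le_exp_of_nonneg hθ
  rw [Real.exp_neg, inv_le_iff_one_le_mul₀ (Real.exp_pos θ)]
  have h2 : 0 ≤ 1 - θ + θ ^ 2 / 2 := by nlinarith [sq_nonneg (θ - 1)]
  calc (1 : ℝ) ≤ (1 - θ + θ ^ 2 / 2) * (1 + θ + θ ^ 2 / 2) := by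
        nlinarith [sq_nonneg (θ ^ 2)]
    _ ≤ _ := by gcongr

theorem bernoulli_exp_neg_le {q θ : ℝ} (h0 : 0 ≤ q) (hθ : 0 ≤ θ) :
    q * Real.exp (-θ) + (1 - q) ≤ Real.exp (-(q * (θ - θ ^ 2 / 2))) := by
  have h1 := Real.add_one_le_exp (-(q * (θ - θ ^ 2 / 2)))
  have h2 := mul_le_mul_of_nonneg_left (exp_neg_le_quadratic hθ) h0
  linarith

/-- For a suitable slope, a count that is much too small lies below the line of the maximal
inequality. -/
theorem exists_crossing_slope {q M L : ℝ} (hq : 0 ≤ q) (hL : 0 < L) :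
    ∃ θ : ℝ, 0 ≤ θ ∧ ∀ c m : ℝ, m ≤ M → c + 3 * √(q * M * L) + 3 * L < q * m →
      θ * c + 2 * L ≤ q * (θ - θ ^ 2 / 2) * m := by
  -- If qM ≤ 2L, the additive 3L suffices with θ = 1. Otherwise Chernoff's slope for mean qM gains
  -- 3√2 L, which covers the quadratic loss of at most L and the intercept 2L.
  rcases le_or_gt (q * M) (2 * L) with hc | hc
  · refine ⟨1, zero_le_one, fun c m hm h => ?_⟩
    have h1 : q * m ≤ q * M := by gcongr
    linarith [Real.sqrt_nonneg (q * M * L)]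
  · have hqM : 0 < q * M := by linarith
    refine ⟨√(2 * L / (q * M)), Real.sqrt_nonneg _, fun c m hm h => ?_⟩
    have hθ2 : √(2 * L / (q * M)) ^ 2 = 2 * L / (q * M) := Real.sq_sqrt (by positivity)
    have hθG : √(2 * L / (q * M)) * √(q * M * L) = √2 * L := by
      rw [← Real.sqrt_mul (by positivity), show 2 * L / (q * M) * (q * M * L) = 2 * L ^ 2 by
        rw [show 2 * L / (q * M) * (q * M * L) = 2 * L / (q * M) * (q * M) * L by ring,
          div_mul_cancel₀ _ hqM.ne']; ring,
        Real.sqrt_mul (by norm_num), Real.sqrt_sq hL.le]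
    have h2 : 1 ≤ √2 := Real.one_le_sqrt.2 (by norm_num)
    have hθ0 := Real.sqrt_nonneg (2 * L / (q * M))
    generalize √(2 * L / (q * M)) = θ at *
    have h3 := mul_le_mul_of_nonneg_left h.le hθ0
    have h4 : q * m * θ ^ 2 ≤ 2 * L := by
      have h1 : q * m ≤ q * M := by gcongr
      calc q * m * θ ^ 2 ≤ q * M * θ ^ 2 := by gcongr
        _ = 2 * L := by rw [hθ2, mul_div_cancel₀ _ hqM.ne']
    have h5 : L ≤ √2 * L := by nlinarith
    have h6 : 0 ≤ θ * (3 * L) := by positivity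
    linarith [show θ * (c + 3 * √(q * M * L) + 3 * L) = θ * c + 3 * (θ * √(q * M * L)) + θ * (3 * L) by ring,
      show q * (θ - θ ^ 2 / 2) * m = θ * (q * m) - q * m * θ ^ 2 / 2 by ring]

variable {k N₀ : ℕ} {δ : ℝ} {μ : Fin k → ℝ} {Ω : Type*} [MeasurableSpace Ω] {P : Measure Ω}
  [IsProbabilityMeasure P] {X : ℕ → Ω → Fin k}

/-- The length of the learning round depends on the items, so all m ≤ N₀ are treated at once by the
maximal inequality. -/
theorem IsItemStream.measureReal_undercount_le (hX : IsItemStream P X μ) (h : Params k N₀ δ)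
    (i : Fin k) : P.real {ω | ∃ m ≤ N₀, counter (fun j => X j ω) 0 m i +
      3 * √(μ i * N₀ * Real.log (k / δ)) + 3 * Real.log (k / δ) < μ i * m} ≤
      Real.exp (-(2 * Real.log (k / δ))) := by
  obtain ⟨θ, hθ, hline⟩ := exists_crossing_slope (M := N₀) (hX.nonneg i)
    (show 0 < Real.log (k / δ) by linarith [h.log_ge])
  refine le_trans (measureReal_mono ?_ (measure_ne_top _ _)) (hX.measureReal_crossing {i} (θ := θ)
    (c := μ i * (θ - θ ^ 2 / 2)) ?_ N₀ 0 (2 * Real.log (k / δ)))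
  · rintro ω ⟨m, hm, hlt⟩
    refine ⟨m, hm, ?_⟩
    rw [← counter_eq_setCount]
    exact hline _ _ (by exact_mod_cast hm) hlt
  · rw [Finset.sum_singleton]
    exact bernoulli_exp_neg_le (hX.nonneg i) hθ

theorem Params.mul_exp_le (h : Params k N₀ δ) :
    k * Real.exp (-(2 * Real.log (k / δ))) ≤ δ / 2 := by
  have hk : (0 : ℝ) < k := by exact_mod_cast h.k_pos
  have hδ := h.pos
  rw [show -(2 * Real.log (k / δ)) = -Real.log (k / δ) + -Real.log (k / δ) by ring, Real.exp_add,
    h.exp_neg_log]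
  have h1 : δ / k ≤ 1 / 2 := by
    rw [div_le_div_iff₀ hk (by norm_num)]
    have := h.two_le
    rw [le_div_iff₀ hδ] at this
    linarith
  calc (k : ℝ) * (δ / k * (δ / k)) = δ * (δ / k) := by field_simp
    _ ≤ δ * (1 / 2) := by gcongr
    _ = _ := by ring

theorem total_counter (a : ℕ → Fin k) (p m : ℕ) : total (counter a p m) = m := by
  unfold total
  exact_mod_cast sum_counter a p m

/-- The counters of the learning round form a good sample unless some player is undercounted. -/
theorem goodSample_counter (hX : IsItemStream P X μ) (h : Params k N₀ δ) {a : ℕ → Fin k} {w : ℕ}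
    (hw : (cmyRule k N₀).EndsAt a 0 w) (hc : ∀ i, μ i * w ≤ counter a 0 w i +
      3 * √(μ i * N₀ * Real.log (k / δ)) + 3 * Real.log (k / δ)) :
    GoodSample δ N₀ μ (counter a 0 w) where
  toParams := h
  nonneg := hX.nonneg
  sum_eq := hX.sum_eq_one
  total_ge := by
    rw [total_counter]
    have h1 : ((k * (N₀ / (2 * k)) : ℕ) : ℝ) ≤ w := by exact_mod_cast le_of_cmyRule_endsAt hw
    have h2 : (N₀ : ℝ) < ((2 * k * (N₀ / (2 * k) + 1) : ℕ) : ℝ) := by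
      exact_mod_cast Nat.lt_mul_div_succ N₀ (by have := h.k_pos; omega)
    have h3 := h.kL_lt h.large
    have h4 := h.kL_ge'
    push_cast at h1 h2
    linarith
  le := by
    intro i
    rw [total_counter]
    exact hc i

end Learning

/-! ### A potential that drops by one in each successful round -/

section Potential

/-- The potential of a round whose threshold is `x` times the scale `k log (k / δ)`, where the
initial threshold is `x₀` times the scale. -/
noncomputable def potential (x₀ x : ℝ) : ℝ :=
  20000000 * (Real.log (Real.log x) + Real.log (1 + Real.log x₀) -
    Real.log (1 + Real.log (x₀ / x)))

variable {x₀ x x' : ℝ}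

theorem one_le_log_of_ge (hx : 84 ≤ x) : 1 ≤ Real.log x := by
  rw [Real.le_log_iff_exp_le (by linarith)]
  linarith [Real.exp_one_lt_d9]

theorem log_div_nonneg (hx : 84 ≤ x) (hle : x ≤ x₀) : 0 ≤ Real.log (x₀ / x) :=
  Real.log_nonneg (by rw [le_div_iff₀ (by linarith)]; linarith)

theorem potential_mono (hx : 84 ≤ x') (hxx : x' ≤ x) (hle : x ≤ x₀) :
    potential x₀ x' ≤ potential x₀ x := by
  have h1 : Real.log (Real.log x') ≤ Real.log (Real.log x) :=
    Real.log_le_log (by linarith [one_le_log_of_ge hx]) (Real.log_le_log (by linarith) hxx)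
  have h2 : Real.log (1 + Real.log (x₀ / x)) ≤ Real.log (1 + Real.log (x₀ / x')) := by
    have := log_div_nonneg (by linarith : 84 ≤ x) hle
    refine Real.log_le_log (by linarith) ?_
    have : Real.log (x₀ / x) ≤ Real.log (x₀ / x') := by
      refine Real.log_le_log (div_pos (by linarith) (by linarith)) ?_
      gcongr; linarith
    linarith
  unfold potential
  linarith

theorem potential_nonneg (hx : 84 ≤ x) (hle : x ≤ x₀) : 0 ≤ potential x₀ x := by
  have h1 := Real.log_nonneg (one_le_log_of_ge hx)
  have h2 : Real.log (1 + Real.log (x₀ / x)) ≤ Real.log (1 + Real.log x₀) := by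
    have := log_div_nonneg hx hle
    refine Real.log_le_log (by linarith) ?_
    have : Real.log (x₀ / x) ≤ Real.log x₀ := by
      refine Real.log_le_log (div_pos (by linarith) (by linarith)) ?_
      exact div_le_self (by linarith) (by linarith)
    linarith
  unfold potential
  linarith

theorem potential_self_le (hx : 84 ≤ x₀) : potential x₀ x₀ ≤ 60000000 * loglog x₀ := by
  have h1 := one_le_log_of_ge hx
  have h2 : Real.log (Real.log x₀) ≤ loglog x₀ :=
    Real.log_le_log (by linarith) (le_max_right _ _)
  have h3 : 1 ≤ loglog x₀ := by
    have := Real.log_le_log (Real.exp_pos 1) (le_max_left (Real.exp 1) (Real.log x₀))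
    rwa [Real.log_exp] at this
  have h4 : Real.log (1 + Real.log x₀) ≤ 1 + loglog x₀ := by
    have h5 : Real.log (2 * Real.log x₀) = Real.log 2 + Real.log (Real.log x₀) :=
      Real.log_mul (by norm_num) (by linarith)
    have h6 : Real.log (1 + Real.log x₀) ≤ Real.log (2 * Real.log x₀) :=
      Real.log_le_log (by linarith) (by linarith)
    linarith [Real.log_two_lt_d9]
  unfold potential
  rw [div_self (by linarith), Real.log_one, add_zero, Real.log_one]
  linarith

theorem potential_le_sub_one_of_log (hx' : 84 ≤ x') (hxx : x' ≤ x) (hle : x ≤ x₀)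
    (h : Real.log x' ≤ (1 - 1 / 10000000) * Real.log x) :
    potential x₀ x' ≤ potential x₀ x - 1 := by
  have hlx := one_le_log_of_ge (hx'.trans hxx)
  have h1 : Real.log (Real.log x') ≤ Real.log (Real.log x) - 1 / 10000000 := by
    calc Real.log (Real.log x') ≤ Real.log ((1 - 1 / 10000000) * Real.log x) :=
          Real.log_le_log (by linarith [one_le_log_of_ge hx']) h
      _ = Real.log (1 - 1 / 10000000) + Real.log (Real.log x) :=
          Real.log_mul (by norm_num) (by linarith)
      _ ≤ _ := by
          have := Real.log_le_sub_one_of_pos (show (0 : ℝ) < 1 - 1 / 10000000 by norm_num)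
          linarith
  have h2 : Real.log (1 + Real.log (x₀ / x)) ≤ Real.log (1 + Real.log (x₀ / x')) := by
    have := log_div_nonneg (by linarith : 84 ≤ x) hle
    refine Real.log_le_log (by linarith) ?_
    have : Real.log (x₀ / x) ≤ Real.log (x₀ / x') := by
      refine Real.log_le_log (div_pos (by linarith) (by linarith)) ?_
      gcongr; linarith
    linarith
  unfold potential
  linarith

/-- The leading constant of `potential` comes from here: log (1 + 10⁻⁷) ≥ 1/20000000. -/
theorem potential_le_sub_one_of_ratio (hx' : 84 ≤ x') (hxx : x' ≤ x) (hle : x ≤ x₀)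
    (h : (1 + 1 / 10000000) * (1 + Real.log (x₀ / x)) ≤ 1 + Real.log (x₀ / x')) :
    potential x₀ x' ≤ potential x₀ x - 1 := by
  have hr := log_div_nonneg (by linarith : 84 ≤ x) hle
  have h1 : Real.log (Real.log x') ≤ Real.log (Real.log x) :=
    Real.log_le_log (by linarith [one_le_log_of_ge hx']) (Real.log_le_log (by linarith) hxx)
  have h2 : Real.log (1 + Real.log (x₀ / x)) + 1 / 20000000 ≤ Real.log (1 + Real.log (x₀ / x')) := by
    calc _ ≤ Real.log (1 + 1 / 10000000) + Real.log (1 + Real.log (x₀ / x)) := by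
          have := Real.one_sub_inv_le_log_of_pos (show (0 : ℝ) < 1 + 1 / 10000000 by norm_num)
          have h3 : (1 / 20000000 : ℝ) ≤ 1 - (1 + 1 / 10000000)⁻¹ := by norm_num
          linarith
      _ = Real.log ((1 + 1 / 10000000) * (1 + Real.log (x₀ / x))) :=
          (Real.log_mul (by norm_num) (by linarith)).symm
      _ ≤ _ := Real.log_le_log (by positivity) h
  unfold potential
  linarith

theorem log_div_le_log_div_sub (hx' : 0 < x') (hx : 0 < x) (hx₀ : 0 < x₀) {c : ℝ} (hc : 0 < c)
    (h : x' ≤ c * x) : Real.log (x₀ / x) - Real.log c ≤ Real.log (x₀ / x') := by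
  rw [Real.log_div hx₀.ne' hx.ne', Real.log_div hx₀.ne' hx'.ne']
  have := Real.log_le_log hx' h
  rw [Real.log_mul hc.ne' hx.ne'] at this
  linarith

/-- Losing a fixed fraction of x lowers log x, and raises log (x₀ / x), by at least 1/60000. This is
a relative change of at least 10⁻⁷ in log x ≤ 84 or in 1 + log (x₀ / x) ≤ 109. -/
theorem potential_step_of_fraction (hx' : 84 ≤ x') (hle : x ≤ x₀)
    (h : x' ≤ (1 - 1 / 60000) * x) (hc : x ≤ 22 ^ 4 ∨ x₀ ≤ 10 ^ 12 * x) :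
    potential x₀ x' ≤ potential x₀ x - 1 := by
  have hlog := Real.log_le_sub_one_of_pos (show (0 : ℝ) < 1 - 1 / 60000 by norm_num)
  have hxx : x' ≤ x := by linarith
  rcases hc with hc | hc
  · refine potential_le_sub_one_of_log hx' hxx hle ?_
    have h1 : Real.log x' ≤ Real.log (1 - 1 / 60000) + Real.log x := by
      rw [← Real.log_mul (by norm_num) (by linarith)]
      exact Real.log_le_log (by linarith) h
    have h2 : Real.log x ≤ 84 := by
      calc Real.log x ≤ Real.log (22 ^ 4) := Real.log_le_log (by linarith) hc
        _ = 4 * Real.log 22 := by rw [Real.log_pow]; norm_num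
        _ ≤ 4 * (22 - 1) := by gcongr; exact Real.log_le_sub_one_of_pos (by norm_num)
        _ = 84 := by norm_num
    linarith
  · refine potential_le_sub_one_of_ratio hx' hxx hle ?_
    have h1 := log_div_le_log_div_sub (x₀ := x₀) (by linarith) (by linarith) (by linarith)
      (by norm_num) h
    have h2 : Real.log (x₀ / x) ≤ 108 := by
      calc Real.log (x₀ / x) ≤ Real.log (10 ^ 12) := by
            refine Real.log_le_log (div_pos (by linarith) (by linarith)) ?_
            rw [div_le_iff₀ (by linarith)]; exact hc
        _ = 12 * Real.log 10 := by rw [Real.log_pow]; norm_num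
        _ ≤ 12 * (10 - 1) := by gcongr; exact Real.log_le_sub_one_of_pos (by norm_num)
        _ = 108 := by norm_num
    linarith

/-- If 10√x dominates, then x' ≤ 20√x, and log x shrinks to at most 3/4 of itself since x ≥ 20⁴.
Otherwise x' ≤ 432√(x / x₀) x, and log (x₀ / x) grows by a factor of at least 5/4 since x₀ / x ≥
432⁴. -/
theorem potential_step_of_near_target (hx' : 84 ≤ x') (hx : 22 ^ 4 ≤ x) (hle : 10 ^ 12 * x ≤ x₀)
    (h : x' ≤ 10 * √x + 216 * √(x / x₀) * x) : potential x₀ x' ≤ potential x₀ x - 1 := by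
  have hx0 : 0 < x := by linarith
  have hx₀ : 0 < x₀ := by linarith
  rcases le_total (216 * √(x / x₀) * x) (10 * √x) with hc | hc
  · have h1 : Real.log x' ≤ 3 / 4 * Real.log x := by
      have h2 : Real.log x' ≤ Real.log (20 * √x) := Real.log_le_log (by linarith) (by linarith)
      rw [Real.log_mul (by norm_num) (Real.sqrt_pos.2 hx0).ne', Real.log_sqrt hx0.le] at h2
      have h3 : 4 * Real.log 20 ≤ Real.log x := by
        rw [show 4 * Real.log 20 = Real.log (20 ^ 4) by rw [Real.log_pow]; norm_num]
        exact Real.log_le_log (by norm_num) (by linarith)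
      linarith
    have hlx := one_le_log_of_ge (x := x) (by linarith)
    refine potential_le_sub_one_of_log hx' ?_ (by linarith) (by linarith)
    rw [← Real.log_le_log_iff (by linarith) hx0]
    linarith
  · have hr : 0 < x / x₀ := by positivity
    have hc' : 0 < 432 * √(x / x₀) := by positivity
    have h1 := log_div_le_log_div_sub (x₀ := x₀) (x' := x') (by linarith) hx0 hx₀ hc'
      (by linarith)
    rw [Real.log_mul (by norm_num) (Real.sqrt_pos.2 hr).ne', Real.log_sqrt hr.le] at h1
    have h2 : Real.log (x / x₀) = -Real.log (x₀ / x) := by rw [← Real.log_inv, inv_div]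
    have h3 : 4 * Real.log 432 ≤ Real.log (x₀ / x) := by
      rw [show 4 * Real.log 432 = Real.log (432 ^ 4) by rw [Real.log_pow]; norm_num]
      refine Real.log_le_log (by norm_num) ?_
      rw [le_div_iff₀ hx0]; linarith
    have h4 := one_le_log_of_ge (x := x₀ / x) (by rw [le_div_iff₀ hx0]; linarith)
    refine potential_le_sub_one_of_ratio hx' ?_ (by linarith) (by linarith)
    have h5 : Real.log (x₀ / x) ≤ Real.log (x₀ / x') := by linarith
    rw [Real.log_le_log_iff (by positivity) (by positivity)] at h5
    rw [div_le_div_iff₀ hx0 (by linarith)] at h5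
    exact le_of_mul_le_mul_left h5 hx₀

end Potential

section Step

variable {k N₀ : ℕ} {δ : ℝ} {μ : Fin k → ℝ} {n : Fin k → ℕ}

/-- The potential of a round with threshold `N`. -/
noncomputable def roundPotential (k : ℕ) (δ : ℝ) (N₀ N : ℕ) : ℝ :=
  potential (N₀ / (k * Real.log (k / δ))) (N / (k * Real.log (k / δ)))

/-- Rounding t/10000 down at most halves it when it is at least 1. Otherwise m = 1 serves, because
no round ends before its first item. -/
theorem GoodSample.exists_fraction (h : GoodSample δ N₀ μ n) {N : ℕ}
    (hN : learnBeta * (k * Real.log (k / δ)) < N) (hle : N ≤ N₀) :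
    ∃ m : ℕ, (Reachable δ N₀ n N m ∨ m ≤ 1) ∧ N / 60000 ≤ (m : ℝ) := by
  have hT := (h.target_bounds hN hle).1
  rcases lt_or_ge (target δ n N / 10000) 1 with hc | hc
  · exact ⟨1, Or.inr le_rfl, by push_cast; linarith⟩
  · refine ⟨⌊target δ n N / 10000⌋₊, Or.inl (Or.inl (Nat.floor_le (by linarith))), ?_⟩
    have h1 := Nat.lt_floor_add_one (target δ n N / 10000)
    have h2 : (1 : ℝ) ≤ ⌊target δ n N / 10000⌋₊ := by
      exact_mod_cast Nat.le_floor (by exact_mod_cast hc)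
    linarith

theorem GoodSample.exists_near_target (h : GoodSample δ N₀ μ n) {N : ℕ}
    (hN : learnBeta * (k * Real.log (k / δ)) < N) (hle : N ≤ N₀)
    (hr : √(N / N₀ : ℝ) ≤ 1 / 1000000) :
    ∃ m : ℕ, Reachable δ N₀ n N m ∧
      N - (m : ℝ) ≤ 10 * (√(k * Real.log (k / δ)) * √N) + 216 * √(N / N₀ : ℝ) * N := by
  obtain ⟨hT1, hT2, -⟩ := h.target_bounds hN hle
  have hT0 := h.target_nonneg hN hle
  have hTN := h.target_le hN hle
  have hρ0 := Real.sqrt_nonneg (N / N₀ : ℝ)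
  have h0 : 0 ≤ (1 - 216 * √(N / N₀ : ℝ)) * target δ n N := mul_nonneg (by linarith) hT0
  refine ⟨⌊(1 - 216 * √(N / N₀ : ℝ)) * target δ n N⌋₊, Or.inr ⟨hr, Nat.floor_le h0⟩, ?_⟩
  have h1 := Nat.lt_floor_add_one ((1 - 216 * √(N / N₀ : ℝ)) * target δ n N)
  have h2 : √(N / N₀ : ℝ) * target δ n N ≤ √(N / N₀ : ℝ) * N := by gcongr
  -- The integer part loses at most 1, covered by the gap between 9.1 and 10.
  have h3 : 0.9 * (√(k * Real.log (k / δ)) * √(N : ℝ)) ≥ 1 := by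
    have hz := h.sqrt_N_ge hN
    have hy2 : √(k * Real.log (k / δ)) ^ 2 = k * Real.log (k / δ) :=
      Real.sq_sqrt (by linarith [h.kL_ge])
    have h4 := mul_le_mul_of_nonneg_left hz (Real.sqrt_nonneg (k * Real.log (k / δ)))
    linarith [h.kL_ge, show √(k * Real.log (k / δ)) * (9.16 * √(k * Real.log (k / δ))) =
      9.16 * √(k * Real.log (k / δ)) ^ 2 by ring]
  linarith

/-- In each round some number of items lowers the potential by one and is collected with good
probability. -/
theorem GoodSample.exists_step (h : GoodSample δ N₀ μ n) {N : ℕ}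
    (hN : learnBeta * (k * Real.log (k / δ)) < N) (hle : N ≤ N₀) :
    ∃ m : ℕ, (Reachable δ N₀ n N m ∨ m ≤ 1) ∧
      (learnBeta * (k * Real.log (k / δ)) < (N - m : ℕ) →
        roundPotential k δ N₀ (N - m) ≤ roundPotential k δ N₀ N - 1) := by
  have hK := h.kL_ge
  have hK0 : 0 < k * Real.log (k / δ) := by linarith
  have hN84 := h.kL_lt hN
  have hN0 : (0 : ℝ) < N := by linarith
  have hN₀ := h.N₀_pos
  have hle' : (N : ℝ) ≤ N₀ := by exact_mod_cast hle
  have hcast : ∀ m : ℕ, learnBeta * (k * Real.log (k / δ)) < (N - m : ℕ) →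
      ((N - m : ℕ) : ℝ) = N - m ∧ 84 ≤ ((N - m : ℕ) : ℝ) / (k * Real.log (k / δ)) := by
    intro m hm
    have h1 := h.kL_lt hm
    refine ⟨?_, by rw [le_div_iff₀ hK0]; exact h1.le⟩
    have h2 : (0 : ℝ) < (N - m : ℕ) := by linarith
    have h3 : 0 < N - m := by exact_mod_cast h2
    exact Nat.cast_sub (by omega)
  have hxle : (N : ℝ) / (k * Real.log (k / δ)) ≤ N₀ / (k * Real.log (k / δ)) := by gcongr
  have hratio : (N : ℝ) / (k * Real.log (k / δ)) / (N₀ / (k * Real.log (k / δ))) = N / N₀ := by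
    rw [div_div_div_cancel_right₀ hK0.ne']
  unfold roundPotential
  by_cases hc : (N : ℝ) / (k * Real.log (k / δ)) ≤ 22 ^ 4 ∨
      (N₀ : ℝ) / (k * Real.log (k / δ)) ≤ 10 ^ 12 * (N / (k * Real.log (k / δ)))
  · obtain ⟨m, hm, hge⟩ := h.exists_fraction hN hle
    refine ⟨m, hm, fun hT => ?_⟩
    obtain ⟨he, h84⟩ := hcast m hT
    refine potential_step_of_fraction h84 hxle ?_ hc
    rw [he, ← mul_div_assoc]
    gcongr
    linarith
  · push Not at hc
    have hr : √(N / N₀ : ℝ) ≤ 1 / 1000000 := by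
      refine Real.sqrt_le_iff.2 ⟨by norm_num, ?_⟩
      have h1 := hc.2
      rw [← mul_div_assoc, div_lt_div_iff_of_pos_right hK0] at h1
      rw [div_le_iff₀ hN₀]
      linarith
    obtain ⟨m, hm, hge⟩ := h.exists_near_target hN hle hr
    refine ⟨m, Or.inl hm, fun hT => ?_⟩
    obtain ⟨he, h84⟩ := hcast m hT
    refine potential_step_of_near_target h84 hc.1.le hc.2.le ?_
    rw [hratio, he, div_le_iff₀ hK0, Real.sqrt_div hN0.le]
    refine hge.trans (le_of_eq ?_)
    have hy : √(k * Real.log (k / δ)) ≠ 0 := (Real.sqrt_pos.2 hK0).ne'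
    have hy2 : √(k * Real.log (k / δ)) ^ 2 = k * Real.log (k / δ) := Real.sq_sqrt hK0.le
    have e1 : 216 * √(N / N₀ : ℝ) * (N / (k * Real.log (k / δ))) * (k * Real.log (k / δ)) =
        216 * √(N / N₀ : ℝ) * N := by
      rw [mul_assoc, div_mul_cancel₀ _ hK0.ne']
    have e2 : 10 * (√(N : ℝ) / √(k * Real.log (k / δ))) * (k * Real.log (k / δ)) =
        10 * (√(k * Real.log (k / δ)) * √N) := by
      nth_rewrite 2 [← hy2]
      field_simp
    rw [add_mul, e1, e2]

end Step

/-! ### The number of learned rounds, with high probability -/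

section Unfinished

variable {k N₀ : ℕ} {δ : ℝ} {μ : Fin k → ℝ} {n : Fin k → ℕ} {Ω : Type*} [MeasurableSpace Ω]
  {P : Measure Ω} [IsProbabilityMeasure P] {X : ℕ → Ω → Fin k}

/-- The left side is 0.995^r · 200^Φ · δ^(r - Φ). The first power beats 200^Φ and the factor 2, and
δ^(r - Φ) ≤ δ; so r need not depend on δ. -/
theorem Params.pow_mul_exp_le (h : Params k N₀ δ) {Φ : ℝ} (hΦ : 0 ≤ Φ) {r : ℕ}
    (hr : 1200 * Φ + 400 ≤ r) :
    (0.99 * δ + δ / 200) ^ r * Real.exp (Real.log (200 / δ) * Φ) ≤ δ / 2 := by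
  have hδ := h.pos
  have hlogδ : Real.log δ ≤ 0 := Real.log_nonpos hδ.le h.lt_one.le
  have h1 : Real.log 0.995 ≤ -0.005 := by
    have := Real.log_le_sub_one_of_pos (show (0 : ℝ) < 0.995 by norm_num)
    linarith
  have h200 : Real.log 200 ≤ 6 := by
    rw [Real.log_le_iff_le_exp (by norm_num)]
    have h2 : Real.exp 6 = Real.exp 1 ^ 6 := by rw [← Real.exp_nat_mul]; norm_num
    have h3 := Real.exp_one_gt_d9
    rw [h2]
    calc (200 : ℝ) ≤ 2.7182818283 ^ 6 := by norm_num
      _ ≤ _ := by gcongr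
  have h2 := Real.log_two_lt_d9
  have e1 : (0.99 * δ + δ / 200) ^ r = Real.exp (r * (Real.log 0.995 + Real.log δ)) := by
    rw [Real.exp_nat_mul, ← Real.log_mul (by norm_num) hδ.ne', Real.exp_log (by positivity)]
    congr 1; ring
  have e2 : δ / 2 = Real.exp (Real.log δ - Real.log 2) := by
    rw [Real.exp_sub, Real.exp_log hδ, Real.exp_log (by norm_num)]
  rw [e1, e2, ← Real.exp_add, Real.log_div (by norm_num) hδ.ne']
  refine Real.exp_le_exp.2 ?_
  have h3 : (r : ℝ) * Real.log 0.995 ≤ (1200 * Φ + 400) * (-0.005) := by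
    have : (r : ℝ) * Real.log 0.995 ≤ r * (-0.005) := by gcongr
    linarith
  have h4 : (r : ℝ) * Real.log δ ≤ (Φ + 1) * Real.log δ :=
    mul_le_mul_of_nonpos_right (by linarith) hlogδ
  have h5 : Real.log 200 * Φ ≤ 6 * Φ := by gcongr
  linarith

theorem Params.ratio_ge (h : Params k N₀ δ) {N : ℕ}
    (hN : learnBeta * (k * Real.log (k / δ)) < N) : 84 ≤ (N : ℝ) / (k * Real.log (k / δ)) := by
  rw [le_div_iff₀ (by linarith [h.kL_ge])]
  exact (h.kL_lt hN).le

theorem Params.roundPotential_mono (h : Params k N₀ δ) {N N' : ℕ}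
    (hN : learnBeta * (k * Real.log (k / δ)) < N') (h1 : N' ≤ N) (h2 : N ≤ N₀) :
    roundPotential k δ N₀ N' ≤ roundPotential k δ N₀ N := by
  have hK := h.kL_ge
  refine potential_mono (h.ratio_ge hN) ?_ ?_ <;> gcongr

theorem GoodSample.measureReal_unfinished_le (h : GoodSample δ N₀ μ n) (hX : IsItemStream P X μ)
    {rule : ℕ → RoundRule k}
    (hfail : ∀ N m : ℕ, learnBeta * (k * Real.log (k / δ)) < N → N ≤ N₀ →
      Reachable δ N₀ n N m ∨ m ≤ 1 → ∀ p,
        P.real {ω | ∃ m' < m, (rule N).EndsAt (fun j => X j ω) p m'} ≤ 0.99 * δ)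
    {r : ℕ} (hr : 1200 * roundPotential k δ N₀ N₀ + 400 ≤ r) (p N : ℕ) (hle : N ≤ N₀) :
    P.real {ω | Unfinished (learnBeta * (k * Real.log (k / δ))) rule (fun j => X j ω) r p N} ≤
      δ / 2 := by
  have hδ := h.pos
  have hΛ : 0 ≤ Real.log (200 / δ) :=
    Real.log_nonneg (by rw [le_div_iff₀ hδ]; linarith [h.lt_one])
  by_cases hN : learnBeta * (k * Real.log (k / δ)) < N
  swap
  · have : {ω | Unfinished (learnBeta * (k * Real.log (k / δ))) rule (fun j => X j ω) r p N} = ∅ :=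
      Set.eq_empty_of_forall_notMem fun ω hω => hN (Unfinished.lt hω)
    rw [this]; simp only [measureReal_empty]; positivity
  -- The weight W = (200/δ)^Φ turns a potential drop of 1 into the factor κ = δ/200.
  refine (hX.measureReal_unfinished_le (N₀ := N₀) (f := 0.99 * δ) (κ := δ / 200)
    (W := fun N => Real.exp (Real.log (200 / δ) * roundPotential k δ N₀ N)) (by positivity)
    (by positivity) ?_ ?_ ?_ r p N hN hle).trans ?_
  · intro N hN hle
    refine Real.one_le_exp (mul_nonneg hΛ (potential_nonneg (h.ratio_ge hN) ?_))
    have hK := h.kL_ge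
    gcongr
  · intro N N' hN' h1 h2
    exact Real.exp_le_exp.2 (mul_le_mul_of_nonneg_left (h.roundPotential_mono hN' h1 h2) hΛ)
  · intro N hN hle
    obtain ⟨m, hm, hstep⟩ := h.exists_step hN hle
    refine ⟨m, fun hT => ?_, hfail N m hN hle hm⟩
    have e : δ / 200 = Real.exp (-Real.log (200 / δ)) := by
      rw [Real.exp_neg, Real.exp_log (by positivity), inv_div]
    rw [e, ← Real.exp_add]
    refine Real.exp_le_exp.2 ?_
    have := mul_le_mul_of_nonneg_left (hstep hT) hΛ
    linarith
  · refine le_trans ?_ (h.pow_mul_exp_le (potential_nonneg (h.ratio_ge h.large) le_rfl) hr)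
    have := h.roundPotential_mono hN hle le_rfl
    simp only [roundPotential] at this ⊢
    gcongr

end Unfinished

/-! ### Assembly of the cost bound -/

section Main

variable {k : ℕ} {δ : ℝ}

theorem one_le_loglog (x : ℝ) : 1 ≤ loglog x := by
  have := Real.log_le_log (Real.exp_pos 1) (le_max_left (Real.exp 1) (Real.log x))
  rwa [Real.log_exp] at this

theorem learnBeta_le : learnBeta ≤ 86 := by
  have h2 : √2 ≤ 1.415 := Real.sqrt_le_iff.2 (by norm_num)
  have h3 : (2 * √2 + 2 / 3 + 3) ^ 2 ≤ (6.4967 : ℝ) ^ 2 := by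
    gcongr
    linarith
  unfold learnBeta
  norm_num at h3 ⊢; linarith

/-- The number of rounds of the CMY algorithm below the switching point. -/
theorem exists_cmy_rounds (hδ : 0 < δ) (h2 : 2 ≤ (k : ℝ) / δ) :
    ∃ j : ℕ, (j : ℝ) ≤ 20 * loglog (k / δ) ∧
      learnBeta * (k * Real.log (k / δ)) < 4 * k * (3 / 2) ^ j := by
  have hk : (0 : ℝ) < k := by exact_mod_cast pos_of_two_le_div hδ h2
  have hL := log_div_ge h2
  have hL0 : 0 < Real.log (k / δ) := by linarith
  have h1 := one_le_loglog (k / δ)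
  refine ⟨⌈18 * loglog (k / δ)⌉₊, ?_, ?_⟩
  · have := Nat.ceil_lt_add_one (show 0 ≤ 18 * loglog (k / δ) by linarith)
    linarith
  set j := ⌈18 * loglog (k / δ)⌉₊
  have hj : 18 * loglog (k / δ) ≤ j := Nat.le_ceil _
  have hlog : Real.log (86 * Real.log (k / δ)) ≤ 6 * loglog (k / δ) := by
    rw [Real.log_mul (by norm_num) hL0.ne']
    have h3 : Real.log 86 ≤ 5 := by
      rw [Real.log_le_iff_le_exp (by norm_num)]
      have h4 : Real.exp 5 = Real.exp 1 ^ 5 := by rw [← Real.exp_nat_mul]; norm_num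
      have h5 := Real.exp_one_gt_d9
      rw [h4]
      calc (86 : ℝ) ≤ 2.7182818283 ^ 5 := by norm_num
        _ ≤ _ := by gcongr
    have h4 : Real.log (Real.log (k / δ)) ≤ loglog (k / δ) :=
      Real.log_le_log hL0 (le_max_right _ _)
    linarith
  have hpow : 86 * Real.log (k / δ) ≤ (3 / 2) ^ j := by
    have h3 : (1 / 3 : ℝ) ≤ Real.log (3 / 2) := by
      have := Real.one_sub_inv_le_log_of_pos (show (0 : ℝ) < 3 / 2 by norm_num)
      norm_num at this ⊢; linarith
    rw [← Real.log_le_log_iff (by positivity) (by positivity), Real.log_pow]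
    have : (j : ℝ) * (1 / 3) ≤ j * Real.log (3 / 2) := by gcongr
    linarith
  calc learnBeta * (k * Real.log (k / δ)) ≤ 86 * (k * Real.log (k / δ)) := by
        gcongr; exact learnBeta_le
    _ = k * (86 * Real.log (k / δ)) := by ring
    _ ≤ k * (3 / 2) ^ j := by gcongr
    _ < 4 * k * (3 / 2) ^ j := by
        have : 0 < (k : ℝ) * (3 / 2) ^ j := by positivity
        linarith

variable {N₀ : ℕ} {μ : Fin k → ℝ} {Ω : Type*} [MeasurableSpace Ω] {P : Measure Ω}
  {X : ℕ → Ω → Fin k}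

theorem measureReal_endsAt_lt_one_le {R : RoundRule k} {m : ℕ} (hm : m ≤ 1)
    (hR : ∀ a p, ¬ R.EndsAt a p 0) (p : ℕ) {b : ℝ} (hb : 0 ≤ b) :
    P.real {ω | ∃ m' < m, R.EndsAt (fun j => X j ω) p m'} ≤ b := by
  have : {ω | ∃ m' < m, R.EndsAt (fun j => X j ω) p m'} = ∅ := by
    refine Set.eq_empty_of_forall_notMem ?_
    rintro ω ⟨m', hm', hend⟩
    obtain rfl : m' = 0 := by omega
    exact hR _ _ hend
  rw [this]; simpa using hb

variable [IsProbabilityMeasure P]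

theorem exists_learningRun_of_le (hδ : 0 < δ) (h2 : 2 ≤ (k : ℝ) / δ)
    (hN : (N₀ : ℝ) ≤ learnBeta * (k * Real.log (k / δ)))
    (learn : (Fin k → ℕ) → ℕ → RoundRule k) (a : ℕ → Fin k) :
    ∃ c : ℕ, LearningRun learnBeta δ learn a N₀ c ∧ (c : ℝ) ≤ 85 * (k * loglog (k / δ)) := by
  have hk := pos_of_two_le_div hδ h2
  have hll := one_le_loglog (k / δ)
  have hkl : (k : ℝ) ≤ k * loglog (k / δ) := le_mul_of_one_le_right (Nat.cast_nonneg _) hll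
  have h5 : ((5 * k : ℕ) : ℝ) ≤ 85 * (k * loglog (k / δ)) := by
    have := Nat.cast_nonneg (α := ℝ) k
    push_cast; linarith
  rcases Nat.eq_zero_or_pos N₀ with rfl | h0
  · exact ⟨0, .alarm, le_trans (by simp) h5⟩
  rcases le_or_gt N₀ (4 * k) with h4 | h4
  · exact ⟨_, .direct N₀ h0 h4, le_trans (by
      exact_mod_cast (by unfold directCost; omega : directCost k N₀ ≤ 5 * k)) h5⟩
  obtain ⟨j, hj, hlt⟩ := exists_cmy_rounds hδ h2
  obtain ⟨c, hc, hle⟩ := exists_cmyRun hk a j 0 N₀ (hN.trans_lt hlt)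
  refine ⟨c, .cmy N₀ c h4 hN hc, ?_⟩
  have hle' : (c : ℝ) ≤ 4 * k * j + 5 * k := by exact_mod_cast hle
  have : (k : ℝ) * j ≤ k * (20 * loglog (k / δ)) := by gcongr
  linarith

/-- The cost bound for any learning algorithm whose rounds collect, with probability at least
`1 - 0.99 δ`, the numbers of items that the counters of the learning round make reachable. -/
theorem IsItemStream.le_measureReal_learningRun (hX : IsItemStream P X μ) (hδ : 0 < δ)
    (hδ1 : δ < 1) (h2 : 2 ≤ (k : ℝ) / δ) {learn : (Fin k → ℕ) → ℕ → RoundRule k}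
    (hcost : ∀ n N, (learn n N).cost ≤ 4 * k)
    (hends : ∀ n, GoodSample δ N₀ μ n → ∀ N : ℕ, N ≤ N₀ → learnBeta * (k * Real.log (k / δ)) < N →
      ∀ a p, ∃ m, (learn n N).EndsAt a p m)
    (hfail : ∀ n, GoodSample δ N₀ μ n → ∀ N m : ℕ, learnBeta * (k * Real.log (k / δ)) < N → N ≤ N₀ →
      Reachable δ N₀ n N m ∨ m ≤ 1 → ∀ p,
        P.real {ω | ∃ m' < m, (learn n N).EndsAt (fun j => X j ω) p m'} ≤ 0.99 * δ) :
    1 - δ ≤ P.real {ω | ∃ c : ℕ, LearningRun learnBeta δ learn (fun j => X j ω) N₀ c ∧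
      (c : ℝ) ≤ 300000000000 * (k * loglog (N₀ / (k * Real.log (k / δ))) + k * loglog (k / δ))} := by
  have hk := pos_of_two_le_div hδ h2
  have hk0 : (0 : ℝ) ≤ k := Nat.cast_nonneg _
  have hl2 := one_le_loglog (k / δ)
  have hl1 := one_le_loglog (N₀ / (k * Real.log (k / δ)))
  have hkl1 : (k : ℝ) ≤ k * loglog (N₀ / (k * Real.log (k / δ))) := le_mul_of_one_le_right hk0 hl1
  have hkl2 : (k : ℝ) ≤ k * loglog (k / δ) := le_mul_of_one_le_right hk0 hl2
  set S := {ω | ∃ c : ℕ, LearningRun learnBeta δ learn (fun j => X j ω) N₀ c ∧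
    (c : ℝ) ≤ 300000000000 * (k * loglog (N₀ / (k * Real.log (k / δ))) + k * loglog (k / δ))} with hS
  rcases le_or_gt (N₀ : ℝ) (learnBeta * (k * Real.log (k / δ))) with hN | hN
  · have : S = Set.univ := by
      refine Set.eq_univ_of_forall fun ω => ?_
      obtain ⟨c, hc, hle⟩ := exists_learningRun_of_le hδ h2 hN learn fun j => X j ω
      exact ⟨c, hc, by linarith⟩
    rw [this, probReal_univ]; linarith
  have hp : Params k N₀ δ := ⟨hδ, hδ1, h2, hN⟩
  set T := learnBeta * (k * Real.log (k / δ)) with hT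
  have h4T : (4 * k : ℝ) ≤ T := by
    have h1 := hp.kL_ge'
    have h3 : 84 * (k * Real.log (k / δ)) ≤ T := by
      rw [hT]; gcongr
      · linarith [hp.kL_ge]
      · exact learnBeta_ge
    linarith
  have h4 : 4 * k < N₀ := by exact_mod_cast h4T.trans_lt hN
  obtain ⟨j, hj, hlt⟩ := exists_cmy_rounds hδ h2
  set r := ⌈1200 * roundPotential k δ N₀ N₀ + 400⌉₊ with hrdef
  have hpot : roundPotential k δ N₀ N₀ ≤ 60000000 * loglog (N₀ / (k * Real.log (k / δ))) :=
    potential_self_le (hp.ratio_ge hN)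
  have hpot0 : 0 ≤ roundPotential k δ N₀ N₀ := potential_nonneg (hp.ratio_ge hN) le_rfl
  have hr : 1200 * roundPotential k δ N₀ N₀ + 400 ≤ r := Nat.le_ceil _
  have hr' : (r : ℝ) ≤ 1200 * (60000000 * loglog (N₀ / (k * Real.log (k / δ)))) + 401 := by
    have := Nat.ceil_lt_add_one (show 0 ≤ 1200 * roundPotential k δ N₀ N₀ + 400 by linarith)
    linarith
  let U : Fin k → Set Ω := fun i => {ω | ∃ m ≤ N₀, counter (fun j => X j ω) 0 m i +
    3 * √(μ i * N₀ * Real.log (k / δ)) + 3 * Real.log (k / δ) < μ i * m}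
  -- Given the length and the counters of the learning round, the later rule is fixed and the later
  -- items are fresh.
  let ι := {q : ℕ × (Fin k → ℕ) // GoodSample δ N₀ μ q.2}
  let A : ι → Set Ω := fun q => {ω | (cmyRule k N₀).EndsAt (fun j => X j ω) 0 q.1.1 ∧
    counter (fun j => X j ω) 0 q.1.1 = q.1.2}
  let B : ι → Set Ω := fun q =>
    {ω | Unfinished T (learn q.1.2) (fun j => X j ω) r q.1.1 (N₀ - q.1.1)}
  -- Outside S either some player is undercounted, or the sample is good and r rounds are not
  -- enough; each has probability at most δ/2.
  have hcover : (Set.univ : Set Ω) ⊆ S ∪ ((⋃ i ∈ (Finset.univ : Finset (Fin k)), U i) ∪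
      ⋃ q, A q ∩ B q) := by
    intro ω _
    by_cases hU : ω ∈ ⋃ i ∈ (Finset.univ : Finset (Fin k)), U i
    · exact Or.inr (Or.inl hU)
    obtain ⟨w, hw⟩ := cmyRule_exists_endsAt hk (by omega : 2 * k ≤ N₀) (fun j => X j ω) 0
    have hwN : w ≤ N₀ := cmyRule_endsAt_le hk (by omega) hw
    have hgood := goodSample_counter hX hp hw fun i => by
      by_contra! hcon
      exact hU (Set.mem_biUnion (Finset.mem_univ i) ⟨w, hwN, hcon⟩)
    by_cases hB : Unfinished T (learn (counter (fun j => X j ω) 0 w)) (fun j => X j ω) r w (N₀ - w)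
    · exact Or.inr (Or.inr (Set.mem_iUnion.2 ⟨⟨(w, _), hgood⟩, ⟨hw, rfl⟩, hB⟩))
    obtain ⟨c, hc, hle⟩ := exists_frameworkRun (B := 4 * k * j + 5 * k) (N₀ := N₀) h4T
      (fun N h1 h3 p => hends _ hgood N h1 h3 _ p) (hcost _) (by omega)
      (fun p N h1 => exists_cmyRun hk _ j p N (h1.trans_lt hlt)) r w (N₀ - w) (Nat.sub_le _ _) hB
    refine Or.inl ⟨_, .learnRound N₀ w c h4 hN hw hc, ?_⟩
    have hc1 : (cmyRule k N₀).cost = 4 * k := by simp only [RoundRule.cost, cmyRule]; ring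
    rw [hc1]
    have hle' : (c : ℝ) ≤ 4 * k * r + (4 * k * j + 5 * k) := by exact_mod_cast hle
    have e1 : (k : ℝ) * j ≤ k * (20 * loglog (k / δ)) := by gcongr
    have e2 := mul_le_mul_of_nonneg_left hr' hk0
    push_cast
    linarith
  have hPU : P.real (⋃ i ∈ (Finset.univ : Finset (Fin k)), U i) ≤ δ / 2 := by
    calc _ ≤ ∑ i : Fin k, P.real (U i) := measureReal_biUnion_finset_le _ _
      _ ≤ ∑ i : Fin k, Real.exp (-(2 * Real.log (k / δ))) :=
          Finset.sum_le_sum fun i _ => hX.measureReal_undercount_le hp i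
      _ = k * Real.exp (-(2 * Real.log (k / δ))) := by simp
      _ ≤ _ := hp.mul_exp_le
  have hPB : P.real (⋃ q, A q ∩ B q) ≤ δ / 2 := by
    refine (hX.measureReal_iUnion_inter_le (fun q : ι => q.1.1) (fun q => ?_)
      (fun q => measurableSet_unfinished _ _ _ _ _) ?_ (b := δ / 2) (by positivity) fun q => ?_).trans
      (mul_le_of_le_one_right (by positivity) measureReal_le_one)
    · refine measurableSet_of_dependsOn (Finset.Ico 0 (0 + q.1.1)) (fun j hj => by simpa using hj)
        (fun a => (cmyRule k N₀).EndsAt a 0 q.1.1 ∧ counter a 0 q.1.1 = q.1.2) ?_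
      rintro a b hab ⟨h1, h3⟩
      exact ⟨h1.congr hab, by rw [← counter_congr hab]; exact h3⟩
    · rintro ⟨⟨w, n⟩, hq⟩ ⟨⟨w', n'⟩, hq'⟩ hne
      refine Set.disjoint_left.2 fun ω h1 h3 => hne (Subtype.ext ?_)
      obtain rfl : w = w' := IsLeast.unique h1.1 h3.1
      exact Prod.ext rfl (h1.2.symm.trans h3.2)
    · exact q.2.measureReal_unfinished_le hX (hfail _ q.2) hr _ _ (Nat.sub_le _ _)
  have h1 : (1 : ℝ) ≤ P.real S + (δ / 2 + δ / 2) := by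
    calc (1 : ℝ) = P.real Set.univ := probReal_univ.symm
      _ ≤ P.real (S ∪ ((⋃ i ∈ (Finset.univ : Finset (Fin k)), U i) ∪ ⋃ q, A q ∩ B q)) :=
          measureReal_mono hcover (measure_ne_top _ _)
      _ ≤ P.real S + (P.real (⋃ i ∈ (Finset.univ : Finset (Fin k)), U i) +
          P.real (⋃ q, A q ∩ B q)) :=
          (measureReal_union_le _ _).trans (by gcongr; exact measureReal_union_le _ _)
      _ ≤ _ := by gcongr
  linarith

end Main

end DistTracking

open MeasureTheory ProbabilityTheory DistTracking in
theorem mainTheorem4 :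
    ∃ C : ℝ, 0 < C ∧
      ∀ (k N : ℕ) (δ : ℝ) (μ : Fin k → ℝ)
        (Ω : Type*) [MeasurableSpace Ω] (P : Measure Ω) [IsProbabilityMeasure P]
        (X : ℕ → Ω → Fin k),
        0 < δ → δ < 1 → 2 ≤ (k : ℝ) / δ →
        (∀ j, Measurable (X j)) → iIndepFun X P →
        (∀ j i, P.real {ω | X j ω = i} = μ i) →
        1 - δ ≤ P.real {ω | ∃ c : ℕ, StcSlkLrnDst δ (fun j => X j ω) N c ∧
            (c : ℝ) ≤ C * (k * loglog (N / (k * Real.log (k / δ))) + k * loglog (k / δ))} ∧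
        1 - δ ≤ P.real {ω | ∃ c : ℕ, DynSlkLrnDst δ (fun j => X j ω) N c ∧
            (c : ℝ) ≤ C * (k * loglog (N / (k * Real.log (k / δ))) + k * loglog (k / δ))} := by
  -- Mainly 4k messages per round times 1200 · 60000000 loglog x₀ rounds, i.e. 2.88 · 10¹¹.
  refine ⟨300000000000, by norm_num, ?_⟩
  intro k N δ μ Ω _ P _ X hδ hδ1 h2 hmeas hind hlaw
  have hX : IsItemStream P X μ := ⟨hmeas, hind, hlaw⟩
  have hk := pos_of_two_le_div hδ h2
  constructor
  · refine hX.le_measureReal_learningRun hδ hδ1 h2 (fun n N => ?_)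
      (fun n h N _ _ a p => h.staticRule_exists_endsAt N a p) fun n h N m hN hle hm p => ?_
    · simp only [RoundRule.cost, learnedStaticRule, staticRule]; omega
    · rcases hm with hm | hm
      · exact h.measureReal_static_le hX hN hle hm p
      · exact measureReal_endsAt_lt_one_le hm (h.staticRule_not_endsAt_zero hN hle) p
          (by positivity)
  · refine hX.le_measureReal_learningRun hδ hδ1 h2 (fun n N => ?_)
      (fun n h N hle hN a p => h.dynamicRule_exists_endsAt hN hle a p) fun n h N m hN hle hm p => ?_
    · simp only [RoundRule.cost, learnedDynamicRule, dynamicRule]; omega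
    · rcases hm with hm | hm
      · exact h.measureReal_dynamic_le hX hN hle hm p
      · exact measureReal_endsAt_lt_one_le hm (h.dynamicRule_not_endsAt_zero hN hle) p
          (by positivity)
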